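/- Let $G$ be a finite graph with a (not necessarily proper) edge colouring. A rainbow path is a path all of whose edges have distinct colours, and the rainbow connection number $\mathrm{rc}(G)$ is the minimum number of colours in an edge colouring of $G$ such that every pair of vertices is joined by at least one rainbow path ($\mathrm{rc}(G)=\infty$ if $G$ is disconnected). Let $\mathcal{G}(n,p)$ denote the random graph on $n$ labelled vertices in which each of the $\binom n2$ potential edges is present independently with probability $p$. Corollary. Let $\omega:\mathbb{N}\to\mathbb{R}$ and $p=p(n)\in[0,1]$ be such that $p(n)=\sqrt{\frac{2\log n+\omega(n)}{n}}$ for all sufficiently large $n$, and suppose that $\omega(n)\to\infty$ and $(1-p(n))\,n^2\to\infty$ as $n\to\infty$. Let $G\sim\mathcal{G}(n,p(n))$. Then $\mathrm{rc}(G)=2$ with high probability, i.e. $\lim_{n\to\infty}\mathbb{P}(\mathrm{rc}(G)=2)=1$. -/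

import Mathlib

open Filter Topology

namespace SimpleGraph

variable {V K : Type*} {G : SimpleGraph V}

/-- With respect to the edge colouring `c`, the walk `w` is a rainbow path: it is a path, and its
edges have pairwise distinct colours. -/
def IsRainbowPath (c : G.EdgeLabeling K) {u v : V} (w : G.Walk u v) : Prop :=
  w.IsPath ∧ (w.darts.map fun d => c ⟨d.edge, d.edge_mem⟩).Nodup

/-- An edge colouring is a rainbow colouring if every pair of vertices is joined by at least one
rainbow path. Colourings need not be proper. -/
def IsRainbowColouring (c : G.EdgeLabeling K) : Prop :=
  ∀ u v : V, u ≠ v → ∃ w : G.Walk u v, IsRainbowPath c w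

variable (G) in
/-- The rainbow connection number of `G`: the minimum number of colours in a rainbow colouring of
`G`. It is `⊤` if there is none with finitely many colours (for a finite graph: if the graph is
disconnected). -/
noncomputable def rainbowConnectionNumber : ℕ∞ :=
  ⨅ k ∈ {k : ℕ | ∃ c : G.EdgeLabeling (Fin k), IsRainbowColouring c}, (k : ℕ∞)

end SimpleGraph

/-! If `G` is not complete then `rc(G) ≥ 2`, and `G` is complete with probability `p ^ (n choose
2)`, which vanishes because `(1 - p) n² → ∞`. For `rc(G) ≤ 2` it suffices to 2-colour the edges so
that each pair of vertices has a path of length two (a cherry) with two colours. In a uniformly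
random colouring, a pair with `d` common neighbours fails with probability `2 ^ (-d)`, and typically
`d` is about `n p²`.

If `p > n ^ (-12/25)`, then `n p² ≥ n ^ (1/25)` and a union bound over the pairs suffices
(`exists_colouring_of_sum_lt`). For smaller `p` the degree `n p²` may be only logarithmic and the
union bound fails, so the local lemma is applied with weights `(3/5) ^ d`
(`IsWellSpread.exists_colouring`). Failure events interact only if their cherries share an edge. The
local lemma then needs three facts about `G`: no pair has `d = 0`; the weights of the pairs with
many common neighbours are locally summable; and the pairs with few common neighbours lie far apart.

These facts hold with high probability by moment bounds, all drawn from one estimate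
(`bernoulliExp_pattern_le`) for the joint exponential moment of several codegrees together with
prescribed edges. The critical term is the expected number of pairs with `d = 0`, of order `n²
exp(-n p²) = exp(-ω)`; the others are negative powers of `n`. -/

/-! ### The local lemma, by counting. -/

open scoped Classical in
/-- The outcomes which avoid every event `A i` with `i ∈ S`. -/
noncomputable def avoiding {ι Ω : Type*} [Fintype Ω] (A : ι → Ω → Prop) (S : Finset ι) : Finset Ω :=
  Finset.univ.filter fun ω => ∀ i ∈ S, ¬ A i ω

open scoped Classical in
theorem card_avoiding_insert {ι Ω : Type*} [Fintype Ω] (A : ι → Ω → Prop) (S : Finset ι) (i : ι) :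
    ((avoiding A (insert i S)).card : ℝ) =
      (avoiding A S).card - ((avoiding A S).filter (A i)).card := by
  have h := Finset.card_filter_add_card_filter_not (s := avoiding A S) (A i)
  have h2 : avoiding A (insert i S) = (avoiding A S).filter fun ω => ¬ A i ω := by
    ext ω; simp [avoiding, and_comm]
  rw [h2, ← h]; push_cast; ring

open scoped Classical in
/-- The **Lovász local lemma** for the uniform measure on a finite set. -/
theorem avoiding_nonempty_of_local {ι Ω : Type*} [Fintype Ω] [Nonempty Ω]
    (A : ι → Ω → Prop) (I : Finset ι) (N : ι → Finset ι) (q x : ι → ℝ)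
    (hx0 : ∀ i, 0 ≤ x i) (hx1 : ∀ i, x i < 1)
    (hq : ∀ i ∈ I, ∀ S ⊆ I, i ∉ S → Disjoint S (N i) →
      (((avoiding A S).filter (A i)).card : ℝ) ≤ q i * (avoiding A S).card)
    (hqx : ∀ i ∈ I, q i ≤ x i * ∏ j ∈ N i, (1 - x j)) :
    (avoiding A I).Nonempty := by
  have key : ∀ m : ℕ, ∀ S ⊆ I, S.card = m → ∀ i ∈ I, i ∉ S →
      (((avoiding A S).filter (A i)).card : ℝ) ≤ x i * (avoiding A S).card := by
    intro m
    induction m using Nat.strong_induction_on with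
    | _ m ih =>
      intro S hS hm i hi hiS
      set S2 := S \ N i with hS2
      -- The events of `S ∩ N i` are restored to `S2` one at a time. Each costs at most a factor `1
      -- - x j` by the induction hypothesis, which applies because `j` itself lies in `S` outside `T
      -- ∪ S2`.
      have hlow : ∀ T ⊆ S ∩ N i,
          (∏ j ∈ T, (1 - x j)) * (avoiding A S2).card ≤ ((avoiding A (T ∪ S2)).card : ℝ) := by
        intro T
        induction T using Finset.induction_on with
        | empty => intro _; simp
        | insert j T hj ihT =>
          intro hT
          have hjS : j ∈ S ∩ N i := hT (Finset.mem_insert_self _ _)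
          have hTS : T ⊆ S ∩ N i := (Finset.subset_insert _ _).trans hT
          have hjn : j ∉ T ∪ S2 := by
            simp only [Finset.mem_union, hj, hS2, Finset.mem_sdiff, false_or]
            exact fun h => h.2 (Finset.mem_inter.1 hjS).2
          have hsub : insert j (T ∪ S2) ⊆ S := by
            intro a ha
            rcases Finset.mem_insert.1 ha with rfl | ha
            · exact (Finset.mem_inter.1 hjS).1
            rcases Finset.mem_union.1 ha with ha | ha
            · exact (Finset.mem_inter.1 (hTS ha)).1
            · exact (Finset.mem_sdiff.1 ha).1
          have hc : (T ∪ S2).card < m := by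
            have := Finset.card_le_card hsub
            rw [Finset.card_insert_of_notMem hjn] at this
            omega
          have h1 := ih _ hc (T ∪ S2) ((Finset.subset_insert _ _).trans (hsub.trans hS)) rfl j
            (hS (hsub (Finset.mem_insert_self _ _))) hjn
          rw [Finset.insert_union, card_avoiding_insert, Finset.prod_insert hj]
          have h2 := mul_le_mul_of_nonneg_left (ihT hTS) (sub_nonneg.2 (hx1 j).le)
          linarith
      have h1 := hlow _ subset_rfl
      have hu : S ∩ N i ∪ S2 = S := by
        rw [hS2, Finset.union_comm]; exact Finset.sdiff_union_inter S (N i)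
      rw [hu] at h1
      have h2 : (((avoiding A S).filter (A i)).card : ℝ) ≤ ((avoiding A S2).filter (A i)).card := by
        refine mod_cast Finset.card_le_card ?_
        intro ω
        simp only [avoiding, Finset.mem_filter, Finset.mem_univ, true_and]
        exact fun h => ⟨fun j hj => h.1 j (Finset.mem_sdiff.1 hj).1, h.2⟩
      have h3 := hq i hi S2 (Finset.sdiff_subset.trans hS)
        (fun h => hiS (Finset.mem_sdiff.1 h).1) Finset.sdiff_disjoint
      have h4 : ∏ j ∈ N i, (1 - x j) ≤ ∏ j ∈ S ∩ N i, (1 - x j) :=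
        Finset.prod_le_prod_of_subset_of_le_one Finset.inter_subset_right
          (fun j _ => sub_nonneg.2 (hx1 j).le) (fun j _ _ => by linarith [hx0 j])
      have h5 : (0 : ℝ) ≤ (avoiding A S2).card := Nat.cast_nonneg _
      calc _ ≤ q i * (avoiding A S2).card := h2.trans h3
        _ ≤ (x i * ∏ j ∈ S ∩ N i, (1 - x j)) * (avoiding A S2).card :=
          mul_le_mul_of_nonneg_right ((hqx i hi).trans (mul_le_mul_of_nonneg_left h4 (hx0 i))) h5
        _ = x i * ((∏ j ∈ S ∩ N i, (1 - x j)) * (avoiding A S2).card) := by ring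
        _ ≤ _ := mul_le_mul_of_nonneg_left h1 (hx0 i)
  have hpos : ∀ T ⊆ I, 0 < ((avoiding A T).card : ℝ) := by
    intro T
    induction T using Finset.induction_on with
    | empty => intro _; simp [avoiding, Fintype.card_pos]
    | insert j T hj ih =>
      intro hT
      have hTI := (Finset.subset_insert _ _).trans hT
      have h1 := key _ T hTI rfl j (hT (Finset.mem_insert_self _ _)) hj
      rw [card_avoiding_insert]
      nlinarith [ih hTI, hx1 j]
  exact Finset.card_pos.1 (by exact_mod_cast hpos I subset_rfl)

/-! ### Monochromatic cherries in a uniformly random 2-colouring. -/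

namespace SimpleGraph

section Colouring
variable {V : Type*} [Fintype V]

open scoped Classical in
/-- The common neighbours of the two ends of `e`. -/
noncomputable def commonNbrs (G : SimpleGraph V) (e : Sym2 V) : Finset V :=
  Finset.univ.filter fun w => ∀ a ∈ e, G.Adj a w

theorem mem_commonNbrs {G : SimpleGraph V} {e : Sym2 V} {w : V} :
    w ∈ G.commonNbrs e ↔ ∀ a ∈ e, G.Adj a w := by simp [commonNbrs]

theorem mem_commonNbrs_mk {G : SimpleGraph V} {u v w : V} :
    w ∈ G.commonNbrs s(u, v) ↔ G.Adj u w ∧ G.Adj v w := by simp [commonNbrs]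

/-- The edges of the paths of length two between the ends of `e`. -/
def cherryEdges (G : SimpleGraph V) (e : Sym2 V) : Set (Sym2 V) :=
  {f | ∃ w ∈ G.commonNbrs e, ∃ a ∈ e, f = s(a, w)}

/-- No path of length two between the ends of `e` is rainbow. -/
def MonoCherries (G : SimpleGraph V) (e : Sym2 V) (c : Sym2 V → Bool) : Prop :=
  ∀ w ∈ G.commonNbrs e, ∀ a ∈ e, ∀ b ∈ e, c s(a, w) = c s(b, w)

theorem monoCherries_congr {G : SimpleGraph V} {e : Sym2 V} {c c' : Sym2 V → Bool}
    (h : ∀ f ∈ G.cherryEdges e, c f = c' f) : G.MonoCherries e c ↔ G.MonoCherries e c' := by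
  refine forall₂_congr fun w hw => forall₂_congr fun a ha => forall₂_congr fun b hb => ?_
  rw [h _ ⟨w, hw, a, ha, rfl⟩, h _ ⟨w, hw, b, hb, rfl⟩]

-- Take a colouring with monochromatic cherries and flip `s(u, w)` for all `w` in a set `T` of
-- common neighbours. The result stays in `B`, which ignores these edges, and `T` can be read off as
-- the set of common neighbours whose two edges now differ. So each such colouring yields `2 ^ d`
-- colourings of `B`, without overlap.
open scoped Classical in
theorem card_filter_monoCherries (G : SimpleGraph V) {e : Sym2 V} (he : ¬ e.IsDiag)
    (B : Finset (Sym2 V → Bool))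
    (hB : ∀ c c', (∀ f ∉ G.cherryEdges e, c f = c' f) → c ∈ B → c' ∈ B) :
    ((B.filter (G.MonoCherries e)).card : ℝ) ≤ (1 / 2) ^ (G.commonNbrs e).card * B.card := by
  induction e with | _ u v
  have huv : u ≠ v := by simpa using he
  set C := G.commonNbrs s(u, v) with hC
  have hcard : (B.filter (G.MonoCherries s(u, v))).card * 2 ^ C.card ≤ B.card := by
    rw [← Finset.card_powerset, ← Finset.card_product]
    let F : (Sym2 V → Bool) × Finset V → (Sym2 V → Bool) :=
      fun cT f => xor (cT.1 f) (decide (∃ w ∈ cT.2, f = s(u, w)))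
    refine Finset.card_le_card_of_injOn F ?_ ?_
    · rintro ⟨c, T⟩ h
      simp only [Finset.coe_product, Set.mem_prod, Finset.mem_coe, Finset.mem_filter,
        Finset.mem_powerset] at h
      refine hB c _ ?_ h.1.1
      intro f hf
      have : ¬ ∃ w ∈ T, f = s(u, w) := by
        rintro ⟨w, hw, rfl⟩
        exact hf ⟨w, h.2 hw, u, by simp, rfl⟩
      simp only [F, this, decide_false, Bool.xor_false]
    · have hv : ∀ c T, T ⊆ C → ∀ w ∈ C, F (c, T) s(v, w) = c s(v, w) := by
        intro c T hT w hw
        have : ¬ ∃ w' ∈ T, s(v, w) = s(u, w') := by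
          rintro ⟨w', hw', h⟩
          rcases Sym2.eq_iff.1 h with h | h
          · exact huv h.1.symm
          · exact G.loopless.irrefl _ (h.1 ▸ (mem_commonNbrs_mk.1 (hT hw')).2)
        simp only [F, this, decide_false, Bool.xor_false]
      have hu : ∀ c T, F (c, T) = fun f => xor (c f) (decide (∃ w ∈ T, f = s(u, w))) :=
        fun _ _ => rfl
      have hT' : ∀ c T, T ⊆ C → G.MonoCherries s(u, v) c → ∀ w,
          w ∈ T ↔ w ∈ C ∧ F (c, T) s(u, w) ≠ F (c, T) s(v, w) := by
        intro c T hT hc w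
        by_cases hw : w ∈ C
        · rw [hv c T hT w hw, ← hc w hw u (by simp) v (by simp)]
          have : (∃ w' ∈ T, s(u, w) = s(u, w')) ↔ w ∈ T := by
            constructor
            · rintro ⟨w', hw', h⟩
              rwa [Sym2.congr_right.1 h]
            · exact fun h => ⟨w, h, rfl⟩
          simp only [hu, this]
          by_cases hwT : w ∈ T <;> simp [hwT, hw]
        · exact ⟨fun h => absurd (hT h) hw, fun h => absurd h.1 hw⟩
      rintro ⟨c, T⟩ h ⟨c', T'⟩ h' heq
      simp only [Finset.coe_product, Set.mem_prod, Finset.mem_coe, Finset.mem_filter,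
        Finset.mem_powerset] at h h'
      have hTT : T = T' := by
        ext w
        rw [hT' c T h.2 h.1.2, hT' c' T' h'.2 h'.1.2, heq]
      subst hTT
      refine Prod.ext ?_ rfl
      funext f
      have := congrFun heq f
      simpa [F] using this
  have h2 : (0 : ℝ) < 2 ^ C.card := by positivity
  rw [one_div, inv_pow, inv_mul_eq_div, le_div_iff₀ h2]
  exact_mod_cast hcard

end Colouring
end SimpleGraph

theorem sum_biUnion_le_of_nonneg {ι κ : Type*} [DecidableEq κ] {s : Finset ι} {t : ι → Finset κ} {f : κ → ℝ}
    (hf : ∀ k, 0 ≤ f k) : ∑ k ∈ s.biUnion t, f k ≤ ∑ i ∈ s, ∑ k ∈ t i, f k := by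
  classical
  induction s using Finset.induction_on with
  | empty => simp
  | insert i s hi ih =>
    rw [Finset.biUnion_insert, Finset.sum_insert hi]
    have h1 := Finset.sum_union_inter (s₁ := t i) (s₂ := s.biUnion t) (f := f)
    have h2 := Finset.sum_nonneg (s := t i ∩ s.biUnion t) fun k _ => hf k
    linarith

namespace SimpleGraph

section Colouring
variable {V : Type*} [Fintype V]

-- Union bound over all pairs; this alone settles the dense regime.
open scoped Classical in
theorem exists_colouring_of_sum_lt (G : SimpleGraph V)
    (h : ∑ e ∈ Finset.univ.filter (fun e : Sym2 V => ¬ e.IsDiag),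
      (1 / 2 : ℝ) ^ (G.commonNbrs e).card < 1) :
    ∃ c : Sym2 V → Bool, ∀ e : Sym2 V, ¬ e.IsDiag → ¬ G.MonoCherries e c := by
  by_contra! hcon
  set I := Finset.univ.filter (fun e : Sym2 V => ¬ e.IsDiag) with hI
  have h1 : (Finset.univ : Finset (Sym2 V → Bool)) ⊆
      I.biUnion fun e => Finset.univ.filter (G.MonoCherries e) := by
    intro c _
    obtain ⟨e, he, hc⟩ := hcon c
    simp only [Finset.mem_biUnion, Finset.mem_filter, Finset.mem_univ, true_and, hI]
    exact ⟨e, he, hc⟩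
  have h2 := (Finset.card_le_card h1).trans Finset.card_biUnion_le
  have h3 : ((Finset.univ : Finset (Sym2 V → Bool)).card : ℝ) ≤
      ∑ e ∈ I, (1 / 2) ^ (G.commonNbrs e).card *
        ((Finset.univ : Finset (Sym2 V → Bool)).card : ℝ) := by
    refine le_trans (mod_cast h2) (le_trans (le_of_eq (Nat.cast_sum _ _)) ?_)
    refine Finset.sum_le_sum fun e he => ?_
    exact G.card_filter_monoCherries (by simpa [hI] using he) _ (fun _ _ _ _ => Finset.mem_univ _)
  rw [← Finset.sum_mul] at h3
  have h4 : (0 : ℝ) < (Finset.univ : Finset (Sym2 V → Bool)).card := by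
    simp
  nlinarith

/-! ### The local lemma for well-spread graphs. -/

/-- A pair of distinct vertices with at most `M` common neighbours. -/
def IsLow (G : SimpleGraph V) (M : ℕ) (e : Sym2 V) : Prop :=
  ¬ e.IsDiag ∧ (G.commonNbrs e).card ≤ M

/-- The neighbours `v` of `w` such that `a` and `v` have more than `M` common neighbours. -/
noncomputable def highNbrs (G : SimpleGraph V) (M : ℕ) (a w : V) : Finset V :=
  open scoped Classical in
  Finset.univ.filter fun v => v ≠ a ∧ G.Adj w v ∧ M < (G.commonNbrs s(a, v)).card

/-- By convexity `exp` lies below its chord over `[-6/5, 0]`, and `exp (-6/5) ≤ 2/5` makes that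
chord at most `1 - x`. -/
theorem exp_neg_two_mul_le {x : ℝ} (h0 : 0 ≤ x) (h1 : x ≤ 3 / 5) :
    Real.exp (-2 * x) ≤ 1 - x := by
  have h := convexOn_exp.2 (Set.mem_univ (-6 / 5 : ℝ)) (Set.mem_univ (0 : ℝ))
    (show 0 ≤ 5 / 3 * x by positivity) (show 0 ≤ 1 - 5 / 3 * x by linarith) (by ring)
  have h2 : Real.exp (-6 / 5) ≤ 2 / 5 := by
    have h3 : (5 / 2 : ℝ) ≤ Real.exp (6 / 5) := by
      have := Real.quadratic_le_exp_of_nonneg (x := 6 / 5) (by norm_num)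
      norm_num at this; linarith
    rw [show (-6 / 5 : ℝ) = -(6 / 5) by ring, Real.exp_neg, inv_le_comm₀ (Real.exp_pos _) (by norm_num)]
    linarith
  simp only [smul_eq_mul, mul_zero, add_zero, Real.exp_zero] at h
  rw [show 5 / 3 * x * (-6 / 5) = -2 * x by ring] at h
  nlinarith

/-- A shared edge joins an end `a` of `e` to a centre `w`. In the cherry of `f` the two vertices
either keep these roles or exchange them, so that `w` is an end of `f` and `a` the centre. -/
theorem exists_of_not_disjoint_cherryEdges {G : SimpleGraph V} {e f : Sym2 V} (hf : ¬ f.IsDiag)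
    (h : ¬ Disjoint (G.cherryEdges e) (G.cherryEdges f)) :
    ∃ w ∈ G.commonNbrs e, ∃ a ∈ e, (∃ v, v ≠ a ∧ f = s(a, v) ∧ G.Adj w v) ∨
      ∃ v, v ≠ w ∧ f = s(w, v) ∧ G.Adj a v := by
  obtain ⟨g, ⟨w, hw, a, ha, rfl⟩, ⟨w', hw', a', ha', heq⟩⟩ := Set.not_disjoint_iff.1 h
  refine ⟨w, hw, a, ha, ?_⟩
  rw [mem_commonNbrs] at hw'
  obtain ⟨v, rfl⟩ := ha'
  have hv := hw' v (by simp)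
  rcases Sym2.eq_iff.1 heq with ⟨rfl, rfl⟩ | ⟨rfl, rfl⟩
  · exact Or.inl ⟨v, fun h => hf (by simp [h]), rfl, hv.symm⟩
  · exact Or.inr ⟨v, fun h => hf (by simp [h]), rfl, hv.symm⟩

/-- Conditions on the pairs with few common neighbours under which the local lemma yields a
rainbow colouring with two colours. -/
structure IsWellSpread (G : SimpleGraph V) (M : ℕ) : Prop where
  commonNbrs_pos : ∀ e : Sym2 V, ¬ e.IsDiag → 0 < (G.commonNbrs e).card
  sum_le : ∀ a w, a ≠ w →
    ∑ v ∈ G.highNbrs M a w, (3 / 5 : ℝ) ^ (G.commonNbrs s(a, v)).card ≤ 1 / 96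
  eq_of_low : ∀ a b c, G.IsLow M s(a, b) → G.IsLow M s(a, c) → b = c
  not_adj_of_low : ∀ a b c d, a ≠ c → a ≠ d → b ≠ c → b ≠ d →
    G.IsLow M s(a, b) → G.IsLow M s(c, d) → ¬ G.Adj a c
  not_adj₃_of_low : ∀ u a b c d, u ≠ d → a ≠ c → a ≠ d → b ≠ c → b ≠ d →
    G.IsLow M s(a, b) → G.IsLow M s(c, d) → ¬ (G.Adj u a ∧ G.Adj u b ∧ G.Adj u c)

theorem IsWellSpread.eq_of_mem {G : SimpleGraph V} {M : ℕ} (h : G.IsWellSpread M) {e f : Sym2 V}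
    {a : V} (hae : a ∈ e) (haf : a ∈ f) (he : G.IsLow M e) (hf : G.IsLow M f) : e = f := by
  obtain ⟨b, rfl⟩ := hae
  obtain ⟨c, rfl⟩ := haf
  rw [h.eq_of_low a b c he hf]

open scoped Classical in
/-- The pairs whose events may depend on the event of the pair `e`. -/
noncomputable def dependent (G : SimpleGraph V) (e : Sym2 V) : Finset (Sym2 V) :=
  Finset.univ.filter fun f => ¬ f.IsDiag ∧ f ≠ e ∧
    ¬ Disjoint (G.cherryEdges e) (G.cherryEdges f)

-- A shared edge is given by a common neighbour `w` of `e` and one of two ends `a`; the two possible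
-- roles of `a` and `w` each contribute at most `1/96`, hence `4/96` for each `w`.
open scoped Classical in
theorem IsWellSpread.sum_dependent_high {G : SimpleGraph V} {M : ℕ} (h : G.IsWellSpread M)
    {e : Sym2 V} (he : ¬ e.IsDiag) :
    ∑ f ∈ (G.dependent e).filter (fun f => ¬ G.IsLow M f), (3 / 5 : ℝ) ^ (G.commonNbrs f).card ≤
      (G.commonNbrs e).card / 24 := by
  let F : V → V → Finset (Sym2 V) := fun a w => (G.highNbrs M a w).image fun v => s(a, v)
  have hF : ∀ a w, a ≠ w → ∑ f ∈ F a w, (3 / 5 : ℝ) ^ (G.commonNbrs f).card ≤ 1 / 96 := by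
    intro a w haw
    rw [Finset.sum_image (fun v _ v' _ hv => Sym2.congr_right.1 hv)]
    exact h.sum_le a w haw
  have hcard : e.toFinset.card = 2 := Sym2.card_toFinset_of_not_isDiag e he
  have hsub : (G.dependent e).filter (fun f => ¬ G.IsLow M f) ⊆
      (G.commonNbrs e).biUnion fun w => e.toFinset.biUnion fun a => F a w ∪ F w a := by
    intro f hf
    simp only [dependent, Finset.mem_filter, Finset.mem_univ, true_and] at hf
    obtain ⟨⟨hfd, hfe, hdis⟩, hlow⟩ := hf
    have hM : M < (G.commonNbrs f).card := by
      by_contra hM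
      exact hlow ⟨hfd, not_lt.1 hM⟩
    obtain ⟨w, hw, a, ha, hor⟩ := exists_of_not_disjoint_cherryEdges hfd hdis
    simp only [Finset.mem_biUnion, Finset.mem_union, Sym2.mem_toFinset]
    refine ⟨w, hw, a, ha, ?_⟩
    rcases hor with ⟨v, hv, rfl, hadj⟩ | ⟨v, hv, rfl, hadj⟩
    · exact Or.inl (Finset.mem_image.2 ⟨v, by simp [highNbrs, hv, hadj, hM], rfl⟩)
    · exact Or.inr (Finset.mem_image.2 ⟨v, by simp [highNbrs, hv, hadj, hM], rfl⟩)
  have hnn : ∀ f, (0 : ℝ) ≤ (3 / 5 : ℝ) ^ (G.commonNbrs f).card := fun f => by positivity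
  calc _ ≤ ∑ f ∈ (G.commonNbrs e).biUnion fun w => e.toFinset.biUnion fun a => F a w ∪ F w a,
        (3 / 5 : ℝ) ^ (G.commonNbrs f).card :=
      Finset.sum_le_sum_of_subset_of_nonneg hsub fun f _ _ => hnn f
    _ ≤ ∑ w ∈ G.commonNbrs e, ∑ a ∈ e.toFinset, (1 / 96 + 1 / 96 : ℝ) := by
      refine (sum_biUnion_le_of_nonneg hnn).trans (Finset.sum_le_sum fun w hw => ?_)
      refine (sum_biUnion_le_of_nonneg hnn).trans (Finset.sum_le_sum fun a ha => ?_)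
      have haw : a ≠ w := (mem_commonNbrs.1 hw a (Sym2.mem_toFinset.1 ha)).ne
      have h1 := Finset.sum_union_inter (s₁ := F a w) (s₂ := F w a)
        (f := fun f => (3 / 5 : ℝ) ^ (G.commonNbrs f).card)
      have h2 := Finset.sum_nonneg (s := F a w ∩ F w a) fun f _ => hnn f
      linarith [hF a w haw, hF w a haw.symm]
    _ = _ := by
      rw [Finset.sum_const, Finset.sum_const, hcard]; simp; ring

-- A dependent low pair would either meet `e`, against `eq_of_low`, or contain a common neighbour of
-- `e`, giving an edge between two disjoint low pairs.
open scoped Classical in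
theorem IsWellSpread.dependent_low_eq_empty {G : SimpleGraph V} {M : ℕ} (h : G.IsWellSpread M)
    {e : Sym2 V} (he : G.IsLow M e) : (G.dependent e).filter (G.IsLow M) = ∅ := by
  rw [Finset.filter_eq_empty_iff]
  intro f hf hlow
  simp only [dependent, Finset.mem_filter, Finset.mem_univ, true_and] at hf
  obtain ⟨hfd, hfe, hdis⟩ := hf
  have hnm : ∀ x ∈ e, x ∉ f := fun x hx hxf => hfe (h.eq_of_mem hxf hx hlow he)
  obtain ⟨w, hw, a, ha, hor⟩ := exists_of_not_disjoint_cherryEdges hfd hdis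
  rcases hor with ⟨v, hv, rfl, hadj⟩ | ⟨v, hv, rfl, hadj⟩
  · exact hnm a ha (by simp)
  · have haw := mem_commonNbrs.1 hw a ha
    obtain ⟨b, rfl⟩ := ha
    have h1 := hnm a (by simp)
    have h2 := hnm b (by simp)
    simp only [Sym2.mem_iff, not_or] at h1 h2
    exact h.not_adj_of_low a b w v h1.1 h1.2 h2.1 h2.2 he hlow haw

-- For each of the two ends `a` of `e`, at most one low pair contains `a` and at most one has both
-- ends adjacent to `a`.
open scoped Classical in
theorem IsWellSpread.card_dependent_low_le {G : SimpleGraph V} {M : ℕ} (h : G.IsWellSpread M)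
    {e : Sym2 V} (he : ¬ e.IsDiag) : ((G.dependent e).filter (G.IsLow M)).card ≤ 4 := by
  let F₁ : V → Finset (Sym2 V) := fun a => Finset.univ.filter fun f => G.IsLow M f ∧ a ∈ f
  let F₂ : V → Finset (Sym2 V) := fun a =>
    Finset.univ.filter fun f => G.IsLow M f ∧ ∀ x ∈ f, G.Adj a x
  have hF₁ : ∀ a, (F₁ a).card ≤ 1 := by
    intro a
    rw [Finset.card_le_one]
    intro f hf g hg
    simp only [F₁, Finset.mem_filter, Finset.mem_univ, true_and] at hf hg
    exact h.eq_of_mem hf.2 hg.2 hf.1 hg.1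
  have hF₂ : ∀ a, (F₂ a).card ≤ 1 := by
    intro a
    rw [Finset.card_le_one]
    intro f hf g hg
    simp only [F₂, Finset.mem_filter, Finset.mem_univ, true_and] at hf hg
    by_contra hfg
    have hnm : ∀ x ∈ f, x ∉ g := fun x hx hxg => hfg (h.eq_of_mem hx hxg hf.1 hg.1)
    induction f with | _ p q
    induction g with | _ r s
    have h1 := hnm p (by simp)
    have h2 := hnm q (by simp)
    simp only [Sym2.mem_iff, not_or] at h1 h2
    exact h.not_adj₃_of_low a p q r s (hg.2 s (by simp)).ne h1.1 h1.2 h2.1 h2.2 hf.1 hg.1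
      ⟨hf.2 p (by simp), hf.2 q (by simp), hg.2 r (by simp)⟩
  have hcard : e.toFinset.card = 2 := Sym2.card_toFinset_of_not_isDiag e he
  have hsub : (G.dependent e).filter (G.IsLow M) ⊆ e.toFinset.biUnion fun a => F₁ a ∪ F₂ a := by
    intro f hf
    simp only [dependent, Finset.mem_filter, Finset.mem_univ, true_and] at hf
    obtain ⟨⟨hfd, hfe, hdis⟩, hlow⟩ := hf
    obtain ⟨w, hw, a, ha, hor⟩ := exists_of_not_disjoint_cherryEdges hfd hdis
    simp only [Finset.mem_biUnion, Finset.mem_union, Sym2.mem_toFinset]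
    refine ⟨a, ha, ?_⟩
    rcases hor with ⟨v, hv, rfl, hadj⟩ | ⟨v, hv, rfl, hadj⟩
    · exact Or.inl (by simp [F₁, hlow])
    · exact Or.inr (by simp [F₂, hlow, hadj, mem_commonNbrs.1 hw a ha])
  calc _ ≤ _ := Finset.card_le_card hsub
    _ ≤ ∑ a ∈ e.toFinset, (F₁ a ∪ F₂ a).card := Finset.card_biUnion_le
    _ ≤ ∑ a ∈ e.toFinset, 2 := Finset.sum_le_sum fun a _ =>
      (Finset.card_union_le _ _).trans (Nat.add_le_add (hF₁ a) (hF₂ a))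
    _ = 4 := by rw [Finset.sum_const, hcard]; rfl

theorem IsWellSpread.sum_dependent {G : SimpleGraph V} {M : ℕ} (hM : 57 ≤ M)
    (h : G.IsWellSpread M) {e : Sym2 V} (he : ¬ e.IsDiag) :
    ∑ f ∈ G.dependent e, (3 / 5 : ℝ) ^ (G.commonNbrs f).card ≤ (G.commonNbrs e).card / 12 := by
  classical
  rw [← Finset.sum_filter_add_sum_filter_not _ (G.IsLow M)]
  have h1 := h.sum_dependent_high he
  have h2 : ∑ f ∈ (G.dependent e).filter (G.IsLow M), (3 / 5 : ℝ) ^ (G.commonNbrs f).card ≤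
      (G.commonNbrs e).card / 24 := by
    by_cases hl : G.IsLow M e
    · rw [h.dependent_low_eq_empty hl, Finset.sum_empty]; positivity
    · have hd : M < (G.commonNbrs e).card := by
        by_contra hd
        exact hl ⟨he, not_lt.1 hd⟩
      -- Four low pairs of weight at most `3/5` fit under `d / 24` as soon as `d ≥ 58`, hence the
      -- requirement `57 ≤ M`.
      have hd' : (58 : ℝ) ≤ (G.commonNbrs e).card := by
        exact_mod_cast (by omega : 58 ≤ (G.commonNbrs e).card)
      have hc : (((G.dependent e).filter (G.IsLow M)).card : ℝ) ≤ 4 :=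
        mod_cast h.card_dependent_low_le he
      have := Finset.sum_le_card_nsmul ((G.dependent e).filter (G.IsLow M))
        (fun f => (3 / 5 : ℝ) ^ (G.commonNbrs f).card) (3 / 5) (by
          intro f hf
          have hfd : ¬ f.IsDiag := (Finset.mem_filter.1 hf).2.1
          exact pow_le_of_le_one (by norm_num) (by norm_num) (h.commonNbrs_pos f hfd).ne')
      rw [nsmul_eq_mul] at this
      linarith
  linarith

/-- The weights `(3/5) ^ d` work because `1/2 = 3/5 · 5/6`: the dependent weights sum to at most `d
/ 12`, so the product of the `1 - x f` is at least `exp (-d/6) ≥ (5/6) ^ d`. -/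
theorem IsWellSpread.exists_colouring {G : SimpleGraph V} {M : ℕ} (hM : 57 ≤ M)
    (h : G.IsWellSpread M) :
    ∃ c : Sym2 V → Bool, ∀ e : Sym2 V, ¬ e.IsDiag → ¬ G.MonoCherries e c := by
  classical
  let x : Sym2 V → ℝ := fun e => if e.IsDiag then 0 else (3 / 5) ^ (G.commonNbrs e).card
  have hx : ∀ e, 0 ≤ x e ∧ x e ≤ 3 / 5 := by
    intro e
    by_cases he : e.IsDiag
    · simp only [x, he, if_true]; norm_num
    · simp only [x, he, if_false]
      exact ⟨by positivity,
        pow_le_of_le_one (by norm_num) (by norm_num) (h.commonNbrs_pos e he).ne'⟩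
  obtain ⟨c, hc⟩ := avoiding_nonempty_of_local (fun e c => G.MonoCherries e c)
    (Finset.univ.filter fun e : Sym2 V => ¬ e.IsDiag) G.dependent
    (fun e => (1 / 2) ^ (G.commonNbrs e).card) x (fun e => (hx e).1)
    (fun e => (hx e).2.trans_lt (by norm_num))
    (by
      intro e he S hS heS hdis
      refine G.card_filter_monoCherries (by simpa using he) _ ?_
      intro c c' hcc hc
      simp only [avoiding, Finset.mem_filter, Finset.mem_univ, true_and] at hc ⊢
      intro f hf hmono
      refine hc f hf ((monoCherries_congr ?_).2 hmono)
      intro g hg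
      refine hcc g fun hge => Finset.disjoint_left.1 hdis hf ?_
      have hfd : ¬ f.IsDiag := by simpa using hS hf
      simp only [dependent, Finset.mem_filter, Finset.mem_univ, true_and]
      exact ⟨hfd, fun h => heS (h ▸ hf), Set.not_disjoint_iff.2 ⟨g, hge, hg⟩⟩)
    (by
      intro e he
      have hed : ¬ e.IsDiag := by simpa using he
      set d := (G.commonNbrs e).card with hd
      have hxe : x e = (3 / 5) ^ d := by simp [x, hed, hd]
      have hsum : ∑ f ∈ G.dependent e, x f ≤ d / 12 := by
        refine le_trans (le_of_eq (Finset.sum_congr rfl fun f hf => ?_)) (h.sum_dependent hM hed)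
        have hfd : ¬ f.IsDiag := (Finset.mem_filter.1 hf).2.1
        simp [x, hfd]
      have h1 : (5 / 6 : ℝ) ^ d ≤ ∏ f ∈ G.dependent e, (1 - x f) := calc
        (5 / 6 : ℝ) ^ d ≤ Real.exp (-1 / 6) ^ d := by
          refine pow_le_pow_left₀ (by norm_num) ?_ _
          have := Real.add_one_le_exp (-1 / 6 : ℝ)
          linarith
        _ = Real.exp (d * (-1 / 6)) := (Real.exp_nat_mul _ _).symm
        _ ≤ Real.exp (∑ f ∈ G.dependent e, -2 * x f) := by
          rw [Real.exp_le_exp, ← Finset.mul_sum]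
          linarith
        _ = ∏ f ∈ G.dependent e, Real.exp (-2 * x f) := Real.exp_sum _ _
        _ ≤ _ := Finset.prod_le_prod (fun f _ => (Real.exp_pos _).le)
          fun f _ => exp_neg_two_mul_le (hx f).1 (hx f).2
      calc ((1 / 2 : ℝ)) ^ d = (3 / 5) ^ d * (5 / 6) ^ d := by rw [← mul_pow]; norm_num
        _ ≤ _ := by
          rw [hxe]
          exact mul_le_mul_of_nonneg_left h1 (by positivity))
  refine ⟨c, fun e he => ?_⟩
  simp only [avoiding, Finset.mem_filter, Finset.mem_univ, true_and] at hc
  exact hc e he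

/-! ### Bounds on the rainbow connection number. -/

theorem rainbowConnectionNumber_le_two {G : SimpleGraph V} {c : Sym2 V → Bool}
    (hc : ∀ e : Sym2 V, ¬ e.IsDiag → ¬ G.MonoCherries e c) : G.rainbowConnectionNumber ≤ 2 := by
  refine iInf₂_le (2 : ℕ) ?_
  refine ⟨fun e => if c e then 1 else 0, fun u v huv => ?_⟩
  have h := hc s(u, v) (by simpa using huv)
  have hex : ∃ w, (G.Adj u w ∧ G.Adj v w) ∧ c s(u, w) ≠ c s(w, v) := by
    by_contra! hcon
    refine h fun w hw a ha b hb => ?_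
    have hw' := mem_commonNbrs_mk.1 hw
    have := hcon w hw'
    rw [Sym2.eq_swap (a := w)] at this
    rw [Sym2.mem_iff] at ha hb
    rcases ha with rfl | rfl <;> rcases hb with rfl | rfl <;> simp [this]
  obtain ⟨w, ⟨h1, h2⟩, hne⟩ := hex
  refine ⟨.cons h1 (.cons h2.symm .nil), ?_, ?_⟩
  · simp [huv, h1.ne, h2.ne.symm]
  · simp only [Walk.darts_cons, Walk.darts_nil, List.map_cons, List.map_nil, List.nodup_cons,
      List.mem_singleton, List.not_mem_nil, not_false_eq_true, List.nodup_nil, and_true, Dart.edge]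
    intro heq
    apply hne
    by_cases ha : c s(u, w) <;> by_cases hb : c s(w, v) <;> simp_all

end Colouring

/-- With at most one colour a rainbow path has at most one edge, which forces all pairs to be
adjacent. -/
theorem two_le_rainbowConnectionNumber {V : Type*} {G : SimpleGraph V} (hG : G ≠ ⊤) :
    2 ≤ G.rainbowConnectionNumber := by
  refine le_iInf₂ fun k hk => ?_
  by_contra hlt
  have hk2 : k ≤ 1 := by
    have : k < 2 := by exact_mod_cast not_le.1 hlt
    omega
  obtain ⟨c, hc⟩ := hk
  apply hG
  ext u v
  rw [top_adj]
  refine ⟨fun h => h.ne, fun huv => ?_⟩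
  obtain ⟨w, -, hw⟩ := hc u v huv
  have hlen := hw.length_le_card
  rw [List.length_map, Walk.length_darts, Fintype.card_fin] at hlen
  cases w with
  | nil => exact absurd rfl huv
  | cons h p =>
    cases p with
    | nil => exact h
    | cons h' p' => simp at hlen; omega
end SimpleGraph

/-! ### Expectations over independent Bernoulli marks. -/

section Bernoulli
variable {ι : Type*}

theorem dependsOn_finset_prod {κ : Type*} (R : Finset κ) {F : κ → (ι → Bool) → ℝ}
    {D : κ → Set ι} {s : Set ι} (hF : ∀ k ∈ R, DependsOn (F k) (D k)) (hD : ∀ k ∈ R, D k ⊆ s) :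
    DependsOn (fun x => ∏ k ∈ R, F k x) s := fun _ _ h =>
  Finset.prod_congr rfl fun k hk => hF k hk fun e he => h e (hD k hk he)

/-- The indicator function of the event that all the coordinates in `D` are `true`. -/
noncomputable def allTrue (D : Finset ι) (x : ι → Bool) : ℝ :=
  open scoped Classical in if ∀ e ∈ D, x e then 1 else 0

theorem allTrue_nonneg (D : Finset ι) (x : ι → Bool) : 0 ≤ allTrue D x := by
  unfold allTrue; split_ifs <;> norm_num

theorem allTrue_le_one (D : Finset ι) (x : ι → Bool) : allTrue D x ≤ 1 := by
  unfold allTrue; split_ifs <;> norm_num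

theorem allTrue_mul [DecidableEq ι] (D D' : Finset ι) (x : ι → Bool) :
    allTrue D x * allTrue D' x = allTrue (D ∪ D') x := by
  simp only [allTrue, Finset.forall_mem_union]
  by_cases h : ∀ e ∈ D, x e = true
  · by_cases h' : ∀ e ∈ D', x e = true
    · rw [if_pos h, if_pos h', if_pos ⟨h, h'⟩, one_mul]
    · rw [if_neg h', if_neg (fun hh : _ ∧ _ => h' hh.2), mul_zero]
  · rw [if_neg h, if_neg (fun hh : _ ∧ _ => h hh.1), zero_mul]

theorem dependsOn_allTrue (D : Finset ι) : DependsOn (allTrue D) (D : Set ι) := by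
  intro x y h
  have : (∀ e ∈ D, x e = true) ↔ ∀ e ∈ D, y e = true :=
    forall₂_congr fun e he => by rw [h e he]
  simp only [allTrue, this]

variable [Fintype ι]

/-- The weight of `x` under the product of Bernoulli distributions with parameter `p`. -/
noncomputable def bernoulliWeight (p : ℝ) (x : ι → Bool) : ℝ := ∏ e, if x e then p else 1 - p

open scoped Classical in
/-- The expectation of `f` under the product of Bernoulli distributions with parameter `p`. -/
noncomputable def bernoulliExp (p : ℝ) (f : (ι → Bool) → ℝ) : ℝ := ∑ x, bernoulliWeight p x * f x

variable {p : ℝ} {f g : (ι → Bool) → ℝ}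

theorem bernoulliExp_prod_apply (p : ℝ) (h : ι → Bool → ℝ) :
    bernoulliExp p (fun x => ∏ e, h e (x e)) = ∏ e, (p * h e true + (1 - p) * h e false) := by
  classical
  have h1 := Finset.prod_univ_sum (fun _ : ι => (Finset.univ : Finset Bool))
    (fun e b => (if b then p else 1 - p) * h e b)
  simp only [Fintype.sum_bool, if_true, Bool.false_eq_true, if_false] at h1
  rw [h1, bernoulliExp, Fintype.piFinset_univ]
  refine Finset.sum_congr ?_ fun x _ => ?_
  · ext; simp
  · rw [bernoulliWeight, Finset.prod_mul_distrib]

theorem bernoulliWeight_nonneg (h0 : 0 ≤ p) (h1 : p ≤ 1) (x : ι → Bool) :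
    0 ≤ bernoulliWeight p x :=
  Finset.prod_nonneg fun e _ => by split_ifs <;> linarith

theorem bernoulliExp_mono (h0 : 0 ≤ p) (h1 : p ≤ 1) (hfg : ∀ x, f x ≤ g x) :
    bernoulliExp p f ≤ bernoulliExp p g :=
  Finset.sum_le_sum fun x _ => mul_le_mul_of_nonneg_left (hfg x) (bernoulliWeight_nonneg h0 h1 x)

theorem bernoulliExp_nonneg (h0 : 0 ≤ p) (h1 : p ≤ 1) (hf : ∀ x, 0 ≤ f x) :
    0 ≤ bernoulliExp p f :=
  Finset.sum_nonneg fun x _ => mul_nonneg (bernoulliWeight_nonneg h0 h1 x) (hf x)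

theorem bernoulliExp_one : bernoulliExp p (fun _ : ι → Bool => 1) = 1 := by
  have := bernoulliExp_prod_apply (ι := ι) p (fun _ _ => 1)
  simpa using this

theorem bernoulliExp_const_mul (c : ℝ) :
    bernoulliExp p (fun x => c * f x) = c * bernoulliExp p f := by
  simp only [bernoulliExp, Finset.mul_sum]
  exact Finset.sum_congr rfl fun x _ => by ring

theorem bernoulliExp_add :
    bernoulliExp p (fun x => f x + g x) = bernoulliExp p f + bernoulliExp p g := by
  simp only [bernoulliExp, mul_add, Finset.sum_add_distrib]

theorem bernoulliExp_sub :
    bernoulliExp p (fun x => f x - g x) = bernoulliExp p f - bernoulliExp p g := by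
  simp only [bernoulliExp, mul_sub, Finset.sum_sub_distrib]

theorem bernoulliExp_sum {κ : Type*} (s : Finset κ) (F : κ → (ι → Bool) → ℝ) :
    bernoulliExp p (fun x => ∑ k ∈ s, F k x) = ∑ k ∈ s, bernoulliExp p (F k) := by
  simp only [bernoulliExp, Finset.mul_sum]
  exact Finset.sum_comm

/-- Write the product of expectations over two independent samples and exchange their coordinates in
`s`. This involution preserves the joint weight and turns `f x * g y` into a function of one sample.
-/
theorem bernoulliExp_mul {s t : Set ι} (hst : Disjoint s t) (hf : DependsOn f s)
    (hg : DependsOn g t) :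
    bernoulliExp p (fun x => f x * g x) = bernoulliExp p f * bernoulliExp p g := by
  classical
  let Φ : (ι → Bool) × (ι → Bool) → (ι → Bool) × (ι → Bool) :=
    fun q => (s.piecewise q.1 q.2, s.piecewise q.2 q.1)
  have hΦ : Function.Involutive Φ := by
    rintro ⟨x, y⟩
    refine Prod.ext ?_ ?_ <;> funext e <;> by_cases he : e ∈ s <;> simp [Φ, Set.piecewise, he]
  have hw : ∀ q, bernoulliWeight p (Φ q).1 * bernoulliWeight p (Φ q).2 =
      bernoulliWeight p q.1 * bernoulliWeight p q.2 := by
    rintro ⟨x, y⟩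
    simp only [bernoulliWeight, ← Finset.prod_mul_distrib, Φ]
    refine Finset.prod_congr rfl fun e _ => ?_
    by_cases he : e ∈ s <;> simp [Set.piecewise, he, mul_comm]
  have h1 : bernoulliExp p f * bernoulliExp p g =
      ∑ q : (ι → Bool) × (ι → Bool),
        bernoulliWeight p (Φ q).1 * bernoulliWeight p (Φ q).2 * (f (Φ q).1 * g (Φ q).1) := by
    rw [bernoulliExp, bernoulliExp, Finset.sum_mul_sum, ← Finset.sum_product']
    refine Finset.sum_congr (by simp) fun q _ => ?_
    have hf' : f (Φ q).1 = f q.1 := hf fun e he => by simp [Φ, Set.piecewise, he]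
    have hg' : g (Φ q).1 = g q.2 := hg fun e he => by
      simp [Φ, Set.piecewise, Set.disjoint_right.1 hst he]
    rw [hw, hf', hg']; ring
  have h2 := Equiv.sum_comp (hΦ.toPerm) fun q =>
    bernoulliWeight p q.1 * bernoulliWeight p q.2 * (f q.1 * g q.1)
  simp only [Function.Involutive.coe_toPerm] at h2
  rw [h1, h2, Fintype.sum_prod_type]
  have h3 : ∑ y : ι → Bool, bernoulliWeight p y = 1 := by
    have := bernoulliExp_one (ι := ι) (p := p)
    simpa [bernoulliExp] using this
  rw [bernoulliExp]
  refine Finset.sum_congr (by simp) fun x _ => ?_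
  dsimp only
  rw [← Finset.sum_mul, ← Finset.mul_sum, h3]; ring

theorem bernoulliExp_prod {κ : Type*} (R : Finset κ) (F : κ → (ι → Bool) → ℝ)
    (D : κ → Set ι) (hF : ∀ k ∈ R, DependsOn (F k) (D k))
    (hD : (R : Set κ).PairwiseDisjoint D) :
    bernoulliExp p (fun x => ∏ k ∈ R, F k x) = ∏ k ∈ R, bernoulliExp p (F k) := by
  classical
  induction R using Finset.induction_on with
  | empty => simp [bernoulliExp_one]
  | insert k R hk ih =>
    simp only [Finset.prod_insert hk]
    rw [← ih (fun l hl => hF l (Finset.mem_insert_of_mem hl))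
      (hD.subset (by simp [Set.subset_insert]))]
    refine bernoulliExp_mul (s := D k) (t := ⋃ l ∈ R, D l) ?_ (hF k (Finset.mem_insert_self _ _)) ?_
    · rw [Set.disjoint_iUnion₂_right]
      intro l hl
      exact hD (by simp) (by simp [hl]) (fun h => hk (h ▸ hl))
    · exact dependsOn_finset_prod R (fun l hl => hF l (Finset.mem_insert_of_mem hl))
        fun l hl => Set.subset_biUnion_of_mem (u := fun l => D l) hl

theorem bernoulliExp_allTrue (D : Finset ι) : bernoulliExp p (allTrue D) = p ^ D.card := by
  classical
  have h := bernoulliExp_prod_apply p fun e b => if e ∈ D then (if b then (1 : ℝ) else 0) else 1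
  have h1 : (fun x : ι → Bool => ∏ e, if e ∈ D then (if x e then (1 : ℝ) else 0) else 1) =
      allTrue D := by
    funext x
    rw [Finset.prod_ite_mem, Finset.univ_inter, Finset.prod_ite_zero, allTrue]
    simp
  rw [h1] at h
  rw [h, ← Finset.prod_const, ← Finset.prod_subset (Finset.subset_univ D)]
  · exact Finset.prod_congr rfl fun e he => by simp [he]
  · intro e _ he
    simp [he]

end Bernoulli

/-- A Bonferroni inequality. -/
theorem prod_one_sub_mul_le {κ : Type*} [DecidableEq κ] {q : ℝ} (hq0 : 0 ≤ q) (hq1 : q ≤ 1)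
    (J : Finset κ) (z : κ → ℝ) (h0 : ∀ j, 0 ≤ z j) (h1 : ∀ j, z j ≤ 1) :
    1 - q * ∑ j ∈ J, z j ≤ ∏ j ∈ J, (1 - q * z j) ∧
    ∏ j ∈ J, (1 - q * z j) ≤ 1 - q * ∑ j ∈ J, z j + ∑ j ∈ J.offDiag, z j.1 * z j.2 := by
  induction J using Finset.induction_on with
  | empty => simp
  | insert k J hk ih =>
    have hS : 0 ≤ ∑ j ∈ J, z j := Finset.sum_nonneg fun j _ => h0 j
    have hP1 : ∏ j ∈ J, (1 - q * z j) ≤ 1 := Finset.prod_le_one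
      (fun j _ => by nlinarith [h0 j, h1 j, mul_le_one₀ hq1 (h0 j) (h1 j)])
      (fun j _ => by nlinarith [mul_nonneg hq0 (h0 j)])
    have hqz : 0 ≤ q * z k := mul_nonneg hq0 (h0 k)
    rw [Finset.prod_insert hk, Finset.sum_insert hk]
    obtain ⟨ih1, ih2⟩ := ih
    -- The lower bound is carried along because the upper bound needs it: the new factor contributes
    -- `-q z k` times the old product. Of the ordered pairs in `offDiag`, only those starting with
    -- `k` are needed to absorb the cross term.
    refine ⟨by nlinarith, ?_⟩
    have hoff : ∑ j ∈ J.offDiag, z j.1 * z j.2 + z k * ∑ j ∈ J, z j ≤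
        ∑ j ∈ (insert k J).offDiag, z j.1 * z j.2 := by
      have h2 : J.offDiag ∪ {k} ×ˢ J ⊆ (insert k J).offDiag := by
        rw [Finset.offDiag_insert hk]
        exact Finset.subset_union_left
      have h3 : Disjoint J.offDiag ({k} ×ˢ J) := by
        rw [Finset.disjoint_left]
        rintro ⟨a, b⟩ h4 h5
        simp only [Finset.mem_offDiag, Finset.mem_product, Finset.mem_singleton] at h4 h5
        exact hk (h5.1 ▸ h4.1)
      refine le_trans (le_of_eq ?_) (Finset.sum_le_sum_of_subset_of_nonneg h2
        fun j _ _ => mul_nonneg (h0 _) (h0 _))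
      rw [Finset.sum_union h3, Finset.sum_product, Finset.sum_singleton, Finset.mul_sum]
    have h4 : q * q * (z k * ∑ j ∈ J, z j) ≤ z k * ∑ j ∈ J, z j :=
      mul_le_of_le_one_left (mul_nonneg (h0 k) hS) (mul_le_one₀ hq1 hq0 hq1)
    nlinarith [mul_le_mul_of_nonneg_left ih1 hqz]

/-! ### The random graph as a function of marks, and joint moments of codegrees. -/

namespace SimpleGraph
variable {V : Type*}

/-- The graph whose edges are the pairs of distinct vertices marked `true`. -/
def ofMarks (x : Sym2 V → Bool) : SimpleGraph V := fromEdgeSet {e | x e}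

theorem ofMarks_adj {x : Sym2 V → Bool} {u v : V} :
    (ofMarks x).Adj u v ↔ x s(u, v) = true ∧ u ≠ v := by simp [ofMarks]

/-- The potential edges between `r` and `A`. -/
noncomputable def star (A : Finset V) (r : V) : Finset (Sym2 V) :=
  open scoped Classical in A.image fun a => s(a, r)

theorem mem_star {A : Finset V} {r : V} {e : Sym2 V} : e ∈ star A r ↔ ∃ a ∈ A, s(a, r) = e := by
  simp [star]

theorem card_star (A : Finset V) (r : V) : (star A r).card = A.card := by
  classical
  exact Finset.card_image_of_injective _ fun _ _ h => Sym2.congr_left.1 h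

theorem star_union [DecidableEq V] (A B : Finset V) (r : V) :
    star (A ∪ B) r = star A r ∪ star B r := by
  ext e; simp [mem_star, or_and_right, exists_or]

variable [Fintype V]

open MeasureTheory unitInterval in
open scoped Classical in
theorem binomialRandom_real_eq (p : unitInterval) (S : Set (SimpleGraph V)) :
    (binomialRandom V p).real S =
      bernoulliExp (p : ℝ) fun x : Sym2 V → Bool => if ofMarks x ∈ S then 1 else 0 := by
  have hsing : ∀ G : SimpleGraph V, (binomialRandom V p).real {G} =
      bernoulliExp (p : ℝ) fun x : Sym2 V → Bool => if ofMarks x = G then 1 else 0 := by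
    intro G
    have h := bernoulliExp_prod_apply (p : ℝ) fun (e : Sym2 V) b =>
      if e.IsDiag then (1 : ℝ) else if (b = true ↔ e ∈ G.edgeSet) then 1 else 0
    have h1 : (fun x : Sym2 V → Bool => ∏ e, if e.IsDiag then (1 : ℝ) else
        if (x e = true ↔ e ∈ G.edgeSet) then 1 else 0) =
        fun x => if ofMarks x = G then 1 else 0 := by
      funext x
      by_cases hx : ofMarks x = G
      · rw [if_pos hx]
        refine Finset.prod_eq_one fun e _ => ?_
        by_cases he : e.IsDiag
        · simp [he]
        · subst hx
          simp [ofMarks, he]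
      · rw [if_neg hx]
        have : ∃ e : Sym2 V, ¬ e.IsDiag ∧ ¬ (x e = true ↔ e ∈ G.edgeSet) := by
          by_contra! hcon
          refine hx ?_
          ext u v
          rw [ofMarks_adj]
          constructor
          · rintro ⟨h1, h2⟩
            exact (hcon s(u, v) (by simpa using h2)).1 h1
          · exact fun h => ⟨(hcon s(u, v) (by simpa using h.ne)).2 h, h.ne⟩
        obtain ⟨e, he1, he2⟩ := this
        exact Finset.prod_eq_zero (Finset.mem_univ e) (by simp [he1, he2])
    rw [h1] at h
    rw [h, measureReal_def, binomialRandom_singleton]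
    -- Diagonal elements of `Sym2 V` carry marks too, but these do not affect the graph and
    -- contribute the factor `p + (1 - p) = 1`.
    have h2 : ∀ e : Sym2 V, ((p : ℝ) * (if e.IsDiag then (1 : ℝ) else
        if ((true : Bool) = true ↔ e ∈ G.edgeSet) then 1 else 0) + (1 - p) *
        (if e.IsDiag then (1 : ℝ) else if ((false : Bool) = true ↔ e ∈ G.edgeSet) then 1 else 0)) =
        (if e ∈ G.edgeFinset then (p : ℝ) else 1) *
        (if e ∈ Finset.univ.filter (fun e : Sym2 V => ¬ e.IsDiag) \ G.edgeFinset
          then (1 - p : ℝ) else 1) := by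
      intro e
      by_cases he : e.IsDiag
      · have : e ∉ G.edgeSet := fun h => G.not_isDiag_of_mem_edgeSet h he
        simp [he, this]
      · by_cases hG : e ∈ G.edgeSet <;> simp [he, hG]
    rw [Finset.prod_congr rfl fun e _ => h2 e, Finset.prod_mul_distrib, Finset.prod_ite_mem,
      Finset.prod_ite_mem, Finset.univ_inter, Finset.univ_inter, Finset.prod_const,
      Finset.prod_const, Finset.card_sdiff_of_subset (by
        intro e he
        simpa using G.not_isDiag_of_mem_edgeSet (mem_edgeFinset.1 he))]
    have h3 : (Finset.univ.filter (fun e : Sym2 V => ¬ e.IsDiag)).card = (Nat.card V).choose 2 := by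
      rw [← Fintype.card_subtype, Sym2.card_subtype_not_diag, Nat.card_eq_fintype_card]
    have h4 : G.edgeSet.ncard = G.edgeFinset.card := by
      rw [Set.ncard_eq_toFinset_card', edgeFinset]
    rw [h3, h4]
    simp [ENNReal.toReal_mul, ENNReal.toReal_pow]
  have hms : ∀ G : SimpleGraph V, MeasurableSet ({G} : Set (SimpleGraph V)) := by
    intro G
    have : ({G} : Set (SimpleGraph V)) = edgeSet ⁻¹' {G.edgeSet} := by
      ext H; simp
    rw [this]
    exact measurable_edgeSet (MeasurableSet.singleton _)
  have hS : S = ⋃ G ∈ Finset.univ.filter (fun G => G ∈ S), {G} := by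
    ext G; simp
  conv_lhs => rw [hS]
  rw [measureReal_biUnion_finset (fun a _ b _ hab => by simpa using hab) fun G _ => hms G]
  rw [Finset.sum_congr rfl fun G _ => hsing G, ← bernoulliExp_sum]
  congr 1
  funext x
  simp

-- Bonferroni for the events that `r` is joined to both ends of `j`. Two distinct pairs span at
-- least three vertices, so two such events occur together with probability at most `p ^ 3`.
open scoped Classical in
theorem bernoulliExp_prod_star_le {p q : ℝ} (hp0 : 0 ≤ p) (hp1 : p ≤ 1) (hq0 : 0 ≤ q) (hq1 : q ≤ 1)
    (J : Finset (Sym2 V)) (hJ : ∀ j ∈ J, ¬ j.IsDiag) (r : V) :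
    bernoulliExp p (fun x => ∏ j ∈ J, (1 - q * allTrue (star j.toFinset r) x)) ≤
      1 - J.card * (q * p ^ 2) + J.card * (J.card - 1) * p ^ 3 := by
  calc _ ≤ bernoulliExp p (fun x => 1 - q * ∑ j ∈ J, allTrue (star j.toFinset r) x +
        ∑ j ∈ J.offDiag, allTrue (star j.1.toFinset r) x * allTrue (star j.2.toFinset r) x) :=
      bernoulliExp_mono hp0 hp1 fun x => (prod_one_sub_mul_le hq0 hq1 J
        (fun j => allTrue (star j.toFinset r) x) (fun j => allTrue_nonneg _ _)
        (fun j => allTrue_le_one _ _)).2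
    _ = 1 - q * ∑ j ∈ J, p ^ j.toFinset.card +
        ∑ j ∈ J.offDiag, p ^ (j.1.toFinset ∪ j.2.toFinset).card := by
      rw [bernoulliExp_add, bernoulliExp_sub, bernoulliExp_one, bernoulliExp_const_mul,
        bernoulliExp_sum, bernoulliExp_sum]
      congr 2
      · congr 1
        refine Finset.sum_congr rfl fun j _ => ?_
        rw [← card_star j.toFinset r]
        exact bernoulliExp_allTrue _
      · funext j
        rw [← card_star _ r, ← bernoulliExp_allTrue, star_union]
        congr 1
        funext x
        exact allTrue_mul _ _ _
    _ ≤ 1 - q * ∑ j ∈ J, p ^ 2 + ∑ j ∈ J.offDiag, p ^ 3 := by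
      refine add_le_add (le_of_eq ?_) (Finset.sum_le_sum fun j hj => ?_)
      · congr 2
        refine Finset.sum_congr rfl fun j hj => ?_
        rw [Sym2.card_toFinset_of_not_isDiag j (hJ j hj)]
      · rw [Finset.mem_offDiag] at hj
        have h1 := Sym2.card_toFinset_of_not_isDiag j.1 (hJ _ hj.1)
        have h2 := Sym2.card_toFinset_of_not_isDiag j.2 (hJ _ hj.2.1)
        have h3 : 2 < (j.1.toFinset ∪ j.2.toFinset).card := by
          by_contra hle
          have h4 := Finset.eq_of_subset_of_card_le
            (Finset.subset_union_left (s₁ := j.1.toFinset) (s₂ := j.2.toFinset)) (by omega)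
          have h5 := Finset.eq_of_subset_of_card_le
            (Finset.subset_union_right (s₁ := j.1.toFinset) (s₂ := j.2.toFinset)) (by omega)
          refine hj.2.2 (Sym2.ext fun a => ?_)
          rw [← Sym2.mem_toFinset, ← Sym2.mem_toFinset, h4, ← h5]
        exact pow_le_pow_of_le_one hp0 hp1 h3
    _ = _ := by
      rw [Finset.sum_const, Finset.sum_const, Finset.offDiag_card, nsmul_eq_mul, nsmul_eq_mul,
        Nat.cast_sub (Nat.le_mul_self _)]
      push_cast; ring

open scoped Classical in
/-- An upper bound for the expectation, in the binomial random graph, of the product of the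
indicators of some edges and of powers of the numbers of common neighbours of some pairs. -/
theorem bernoulliExp_pattern_le {p q : ℝ} (hp0 : 0 ≤ p) (hp1 : p ≤ 1) (hq0 : 0 ≤ q) (hq1 : q ≤ 1)
    (S : Finset V) (J D : Finset (Sym2 V)) (hJ : ∀ j ∈ J, ¬ j.IsDiag)
    (hJS : ∀ j ∈ J, ∀ a ∈ j, a ∈ S) (hDS : ∀ e ∈ D, ∀ a ∈ e, a ∈ S) :
    bernoulliExp p (fun x => allTrue D x * ∏ j ∈ J, (1 - q) ^ ((ofMarks x).commonNbrs j).card) ≤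
      p ^ D.card * Real.exp (-(J.card * (q * (Fintype.card V * p ^ 2))) +
        J.card * (J.card - 1) * (Fintype.card V * p ^ 3) + J.card * S.card * p ^ 2) := by
  -- Only common neighbours `r` outside `S` are counted. Their edges to `S` are disjoint for
  -- different `r` and disjoint from `D`, so the expectation factorises. Discarding the vertices of
  -- `S` costs the term `|J| |S| p²` in the exponent.
  set φ : V → (Sym2 V → Bool) → ℝ := fun r x =>
    ∏ j ∈ J, (1 - q * allTrue (star j.toFinset r) x) with hφ
  have hφ0 : ∀ r x, 0 ≤ φ r x := fun r x => Finset.prod_nonneg fun j _ => by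
    nlinarith [allTrue_nonneg (star j.toFinset r) x, allTrue_le_one (star j.toFinset r) x]
  have hbound : ∀ x, ∏ j ∈ J, (1 - q) ^ ((ofMarks x).commonNbrs j).card ≤ ∏ r ∈ Sᶜ, φ r x := by
    intro x
    simp only [hφ]
    rw [Finset.prod_comm]
    refine Finset.prod_le_prod (fun j _ => pow_nonneg (by linarith) _) fun j hj => ?_
    have h1 : ∀ r ∈ Sᶜ, 1 - q * allTrue (star j.toFinset r) x =
        if r ∈ (ofMarks x).commonNbrs j then 1 - q else 1 := by
      intro r hr
      have : (∀ e ∈ star j.toFinset r, x e = true) ↔ r ∈ (ofMarks x).commonNbrs j := by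
        simp only [mem_star, forall_exists_index, and_imp, forall_apply_eq_imp_iff₂,
          Sym2.mem_toFinset, mem_commonNbrs, ofMarks_adj]
        refine forall₂_congr fun a ha => ⟨fun h => ⟨h, ?_⟩, fun h => h.1⟩
        rintro rfl
        exact Finset.mem_compl.1 hr (hJS j hj _ ha)
      simp only [allTrue, this]
      split_ifs <;> ring
    rw [Finset.prod_congr rfl h1, Finset.prod_ite_mem, Finset.prod_const]
    exact pow_le_pow_of_le_one (by linarith) (by linarith)
      (Finset.card_le_card Finset.inter_subset_right)
  have hdisj : ∀ r ∈ Sᶜ, ∀ e ∈ star S r, ∀ a ∈ e, a ∉ S → a = r := by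
    intro r hr e he a ha haS
    obtain ⟨b, hb, rfl⟩ := mem_star.1 he
    rcases Sym2.mem_iff.1 ha with rfl | rfl
    · exact absurd hb haS
    · rfl
  have hrmem : ∀ r, ∀ e ∈ star S r, r ∈ e := by
    intro r e he
    obtain ⟨b, hb, rfl⟩ := mem_star.1 he
    simp
  have hdep : ∀ r ∈ Sᶜ, DependsOn (φ r) (star S r : Set (Sym2 V)) := by
    intro r hr
    refine dependsOn_finset_prod J (D := fun j => (star j.toFinset r : Set (Sym2 V))) ?_ ?_
    · intro j hj x y h
      simp only [dependsOn_allTrue _ h]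
    · intro j hj e he
      obtain ⟨a, ha, rfl⟩ := mem_star.1 he
      exact mem_star.2 ⟨a, hJS j hj a (Sym2.mem_toFinset.1 ha), rfl⟩
  have hfac : bernoulliExp p (fun x => allTrue D x * ∏ r ∈ Sᶜ, φ r x) =
      p ^ D.card * ∏ r ∈ Sᶜ, bernoulliExp p (φ r) := by
    rw [← bernoulliExp_prod Sᶜ φ (fun r => (star S r : Set (Sym2 V))) hdep, ← bernoulliExp_allTrue]
    · refine bernoulliExp_mul (s := D) (t := ⋃ r ∈ Sᶜ, (star S r : Set (Sym2 V))) ?_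
        (dependsOn_allTrue D) (dependsOn_finset_prod _ hdep fun r hr =>
          Set.subset_biUnion_of_mem (u := fun r => (star S r : Set (Sym2 V))) hr)
      rw [Set.disjoint_iUnion₂_right]
      intro r hr
      rw [Set.disjoint_left]
      exact fun e he he' => Finset.mem_compl.1 hr (hDS e he r (hrmem r e he'))
    · intro r hr r' hr' hne
      refine Set.disjoint_left.2 fun e he he' => hne ?_
      exact hdisj r' hr' e he' r (hrmem r e he) (Finset.mem_compl.1 hr)
  set m : ℝ := (J.card : ℝ) with hm
  have hm0 : 0 ≤ m := Nat.cast_nonneg _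
  have hmm : 0 ≤ m * (m - 1) := by
    rcases Nat.eq_zero_or_pos J.card with h | h
    · simp [hm, h]
    · have : (1 : ℝ) ≤ m := by rw [hm]; exact_mod_cast Nat.succ_le_of_lt h
      exact mul_nonneg hm0 (by linarith)
  have hcard : ((Sᶜ.card : ℕ) : ℝ) = Fintype.card V - S.card := by
    rw [Finset.card_compl, Nat.cast_sub (Finset.card_le_univ S)]
  calc _ ≤ bernoulliExp p (fun x => allTrue D x * ∏ r ∈ Sᶜ, φ r x) :=
      bernoulliExp_mono hp0 hp1 fun x =>
        mul_le_mul_of_nonneg_left (hbound x) (allTrue_nonneg _ _)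
    _ = p ^ D.card * ∏ r ∈ Sᶜ, bernoulliExp p (φ r) := hfac
    _ ≤ p ^ D.card * ∏ r ∈ Sᶜ, Real.exp (-(m * (q * p ^ 2)) + m * (m - 1) * p ^ 3) := by
      refine mul_le_mul_of_nonneg_left (Finset.prod_le_prod
        (fun r _ => bernoulliExp_nonneg hp0 hp1 (hφ0 r)) fun r _ => ?_) (pow_nonneg hp0 _)
      refine (bernoulliExp_prod_star_le hp0 hp1 hq0 hq1 J hJ r).trans ?_
      have := Real.add_one_le_exp (-(m * (q * p ^ 2)) + m * (m - 1) * p ^ 3)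
      linarith
    _ ≤ _ := by
      refine mul_le_mul_of_nonneg_left ?_ (pow_nonneg hp0 _)
      rw [Finset.prod_const, ← Real.exp_nat_mul, Real.exp_le_exp, hcard]
      have h1 : 0 ≤ (S.card : ℝ) * (m * (m - 1) * p ^ 3) := by positivity
      have h2 : (S.card : ℝ) * (m * p ^ 2) * q ≤ (S.card : ℝ) * (m * p ^ 2) :=
        mul_le_of_le_one_right (by positivity) hq1
      nlinarith

end SimpleGraph

/-! ### Probabilities and union bounds. -/

section Bernoulli
variable {ι : Type*} [Fintype ι] {p : ℝ}

/-- The probability of `P` under the product of Bernoulli distributions with parameter `p`. -/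
noncomputable def bernoulliProb (p : ℝ) (P : (ι → Bool) → Prop) : ℝ :=
  open scoped Classical in bernoulliExp p fun x => if P x then 1 else 0

theorem bernoulliProb_le_exp (h0 : 0 ≤ p) (h1 : p ≤ 1) {P : (ι → Bool) → Prop}
    {f : (ι → Bool) → ℝ} (hf : ∀ x, 0 ≤ f x) (hP : ∀ x, P x → 1 ≤ f x) :
    bernoulliProb p P ≤ bernoulliExp p f := by
  refine bernoulliExp_mono h0 h1 fun x => ?_
  split_ifs with h
  · exact hP x h
  · exact hf x

theorem bernoulliProb_mono (h0 : 0 ≤ p) (h1 : p ≤ 1) {P Q : (ι → Bool) → Prop}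
    (hPQ : ∀ x, P x → Q x) : bernoulliProb p P ≤ bernoulliProb p Q := by
  classical
  refine bernoulliProb_le_exp h0 h1 (fun x => by split_ifs <;> norm_num) fun x hx => ?_
  rw [if_pos (hPQ x hx)]

theorem bernoulliProb_or_le (h0 : 0 ≤ p) (h1 : p ≤ 1) (P Q : (ι → Bool) → Prop) :
    bernoulliProb p (fun x => P x ∨ Q x) ≤ bernoulliProb p P + bernoulliProb p Q := by
  classical
  rw [bernoulliProb, bernoulliProb, bernoulliProb, ← bernoulliExp_add]
  refine bernoulliExp_mono h0 h1 fun x => ?_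
  by_cases hP : P x <;> by_cases hQ : Q x <;> simp [hP, hQ]

theorem bernoulliProb_exists_le {κ : Type*} [Fintype κ] (h0 : 0 ≤ p) (h1 : p ≤ 1)
    (P : κ → (ι → Bool) → Prop) {B : ℝ} (hB : ∀ k, bernoulliProb p (P k) ≤ B) :
    bernoulliProb p (fun x => ∃ k, P k x) ≤ Fintype.card κ * B := by
  classical
  have h : bernoulliProb p (fun x => ∃ k, P k x) ≤ ∑ k, bernoulliProb p (P k) := by
    simp only [bernoulliProb]
    rw [← bernoulliExp_sum]
    refine bernoulliExp_mono h0 h1 fun x => ?_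
    have hnn : ∀ k ∈ Finset.univ, (0 : ℝ) ≤ if P k x then 1 else 0 := fun k _ => by
      split_ifs <;> norm_num
    split_ifs with hx
    · obtain ⟨k, hk⟩ := hx
      refine le_trans ?_ (Finset.single_le_sum hnn (Finset.mem_univ k))
      rw [if_pos hk]
    · exact Finset.sum_nonneg hnn
  refine h.trans ((Finset.sum_le_sum fun k _ => hB k).trans ?_)
  simp

theorem bernoulliProb_false {P : (ι → Bool) → Prop} (hP : ∀ x, ¬ P x) : bernoulliProb p P = 0 := by
  simp [bernoulliProb, bernoulliExp, hP]

/-- Lets deterministic side conditions, such as distinctness of vertices, sit inside an event and be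
assumed when bounding it. -/
theorem bernoulliProb_le_zero_or {P : (ι → Bool) → Prop} {Q : Prop} {B : ℝ} (hB : 0 ≤ B)
    (hPQ : ∀ x, P x → Q) (h : Q → bernoulliProb p P ≤ B) : bernoulliProb p P ≤ B := by
  by_cases hQ : Q
  · exact h hQ
  · rw [bernoulliProb_false fun x hx => hQ (hPQ x hx)]
    exact hB

theorem bernoulliProb_compl {P : (ι → Bool) → Prop} :
    bernoulliProb p P = 1 - bernoulliProb p (fun x => ¬ P x) := by
  classical
  rw [eq_sub_iff_add_eq, ← bernoulliExp_one (ι := ι) (p := p), bernoulliProb, bernoulliProb,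
    ← bernoulliExp_add]
  congr 1
  funext x
  by_cases h : P x <;> simp [h]

end Bernoulli

/-! ### Factorial moments of weighted sums. -/

section TupleSum
variable {V : Type*} [DecidableEq V]

/-- The sum of `∏ Z vᵢ` over all `k`-tuples of distinct elements `vᵢ` of `T`. -/
def tupleSum (Z : V → ℝ) : ℕ → Finset V → ℝ
  | 0, _ => 1
  | k + 1, T => ∑ v ∈ T, Z v * tupleSum Z k (T.erase v)

theorem tupleSum_nonneg {Z : V → ℝ} (h0 : ∀ v, 0 ≤ Z v) (k : ℕ) (T : Finset V) :
    0 ≤ tupleSum Z k T := by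
  induction k generalizing T with
  | zero => exact zero_le_one
  | succ k ih => exact Finset.sum_nonneg fun v _ => mul_nonneg (h0 v) (ih _)

/-- Choosing one element removes weight at most 1, so the remaining elements still have total weight
at least `k`. -/
theorem one_le_tupleSum {Z : V → ℝ} (h0 : ∀ v, 0 ≤ Z v) (h1 : ∀ v, Z v ≤ 1) (k : ℕ)
    (T : Finset V) (h : (k : ℝ) ≤ ∑ v ∈ T, Z v) : 1 ≤ tupleSum Z k T := by
  induction k generalizing T with
  | zero => exact le_rfl
  | succ k ih =>
    push_cast at h
    have hk : (0 : ℝ) ≤ k := Nat.cast_nonneg k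
    calc (1 : ℝ) ≤ ∑ v ∈ T, Z v := by linarith
      _ ≤ ∑ v ∈ T, Z v * tupleSum Z k (T.erase v) := by
        refine Finset.sum_le_sum fun v hv => le_mul_of_one_le_right (h0 v) (ih _ ?_)
        have := Finset.add_sum_erase T Z hv
        linarith [h1 v]
      _ = _ := rfl

/-- The set `A` holds the elements already chosen, so that the induction ends at the hypothesis on
`m`-sets. -/
theorem bernoulliExp_tupleSum_le {ι : Type*} [Fintype ι] [Fintype V] {p : ℝ}
    (Z : (ι → Bool) → V → ℝ) {B : ℝ} (m : ℕ) (hB0 : 0 ≤ B)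
    (hB : ∀ A : Finset V, A.card = m → bernoulliExp p (fun x => ∏ v ∈ A, Z x v) ≤ B)
    (k : ℕ) (A T : Finset V) (hAT : Disjoint A T) (hA : A.card + k = m) :
    bernoulliExp p (fun x => (∏ v ∈ A, Z x v) * tupleSum (Z x) k T) ≤ Fintype.card V ^ k * B := by
  induction k generalizing A T with
  | zero => simpa [tupleSum] using hB A (by omega)
  | succ k ih =>
    have h1 : bernoulliExp p (fun x => (∏ v ∈ A, Z x v) * tupleSum (Z x) (k + 1) T) =
        ∑ v ∈ T, bernoulliExp p
          (fun x => (∏ u ∈ insert v A, Z x u) * tupleSum (Z x) k (T.erase v)) := by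
      rw [← bernoulliExp_sum]
      congr 1
      funext x
      rw [tupleSum, Finset.mul_sum]
      refine Finset.sum_congr rfl fun v hv => ?_
      rw [Finset.prod_insert (Finset.disjoint_right.1 hAT hv)]
      ring
    rw [h1]
    have h2 : ∀ v ∈ T, bernoulliExp p
        (fun x => (∏ u ∈ insert v A, Z x u) * tupleSum (Z x) k (T.erase v)) ≤
          Fintype.card V ^ k * B := by
      intro v hv
      refine ih _ _ ?_ ?_
      · rw [Finset.disjoint_insert_left]
        exact ⟨Finset.notMem_erase _ _, hAT.mono_right (Finset.erase_subset _ _)⟩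
      · rw [Finset.card_insert_of_notMem (Finset.disjoint_right.1 hAT hv)]
        omega
    refine (Finset.sum_le_sum h2).trans ?_
    rw [Finset.sum_const, nsmul_eq_mul, pow_succ']
    have h3 : (T.card : ℝ) ≤ Fintype.card V := by exact_mod_cast Finset.card_le_univ T
    have h4 : 0 ≤ (Fintype.card V : ℝ) ^ k * B := by positivity
    nlinarith

end TupleSum

/-! ### Moment bounds for the well-spread conditions. -/

namespace SimpleGraph
theorem allTrue_eq_one {V : Type*} {D : Finset (Sym2 V)} {x : Sym2 V → Bool}
    (h : ∀ e ∈ D, e ∈ (ofMarks x).edgeSet) : allTrue D x = 1 := by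
  rw [allTrue, if_pos]
  intro e he
  have := h e he
  simp only [ofMarks, edgeSet_fromEdgeSet] at this
  exact this.1

variable {V : Type*} [Fintype V] {p : ℝ}

theorem bernoulliProb_commonNbrs_eq_empty_le (h0 : 0 ≤ p) (h1 : p ≤ 1) {e : Sym2 V}
    (he : ¬ e.IsDiag) :
    bernoulliProb p (fun x => ((ofMarks x).commonNbrs e).card = 0) ≤
      Real.exp 2 * Real.exp (-(Fintype.card V * p ^ 2)) := by
  classical
  -- For `q = 1` the power `(1 - q) ^ d` is the indicator of `d = 0`, as `0 ^ 0 = 1`.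
  have h := bernoulliExp_pattern_le (q := 1) h0 h1 zero_le_one le_rfl e.toFinset {e} ∅
    (by simpa using he) (by simp) (by simp)
  have hc := Sym2.card_toFinset_of_not_isDiag e he
  refine (bernoulliProb_le_exp h0 h1 (fun x => ?_) fun x hx => ?_).trans (h.trans ?_)
  · exact mul_nonneg (allTrue_nonneg _ _) (Finset.prod_nonneg fun j _ => by positivity)
  · simp [allTrue, hx]
  · rw [hc, ← Real.exp_add]
    simp only [Finset.card_empty, Finset.card_singleton, pow_zero, one_mul, Real.exp_le_exp]
    push_cast
    nlinarith [pow_le_one₀ (n := 2) h0 h1]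

/-- Exponential Markov inequality: `16 ^ (M - d) ≥ 1` on a low pair, which is the pattern bound with
`q = 15/16`. Two pairs give the exponent `2 · 15/16`; `exp 12` absorbs the errors `2 · 1` and `2 ·
5`. -/
theorem bernoulliProb_two_low_le (h0 : 0 ≤ p) (h1 : p ≤ 1) (hp3 : Fintype.card V * p ^ 3 ≤ 1)
    (M : ℕ) (S : Finset V) (hS : S.card ≤ 5) (D : Finset (Sym2 V)) {e f : Sym2 V} (hef : e ≠ f)
    (he : ∀ a ∈ e, a ∈ S) (hf : ∀ a ∈ f, a ∈ S) (hD : ∀ g ∈ D, ∀ a ∈ g, a ∈ S) :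
    bernoulliProb p (fun x => (ofMarks x).IsLow M e ∧ (ofMarks x).IsLow M f ∧
        ∀ g ∈ D, g ∈ (ofMarks x).edgeSet) ≤
      16 ^ (2 * M) * Real.exp 12 * (p ^ D.card *
        Real.exp (-(15 / 8 * (Fintype.card V * p ^ 2)))) := by
  classical
  refine bernoulliProb_le_zero_or (by positivity) (Q := ¬ e.IsDiag ∧ ¬ f.IsDiag)
    (fun x hx => ⟨hx.1.1, hx.2.1.1⟩) fun ⟨hed, hfd⟩ => ?_
  have h := bernoulliExp_pattern_le (q := 15 / 16) h0 h1 (by norm_num) (by norm_num) S {e, f} D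
    (by simp [hed, hfd]) (by simp only [Finset.mem_insert, Finset.mem_singleton]
                             rintro j (rfl | rfl); exacts [he, hf]) hD
  rw [Finset.card_pair hef] at h
  have h2 : bernoulliProb p (fun x => (ofMarks x).IsLow M e ∧ (ofMarks x).IsLow M f ∧
        ∀ g ∈ D, g ∈ (ofMarks x).edgeSet) ≤ bernoulliExp p (fun x => 16 ^ (2 * M) *
      (allTrue D x * ∏ j ∈ {e, f}, (1 - 15 / 16) ^ ((ofMarks x).commonNbrs j).card)) := by
    refine bernoulliProb_le_exp h0 h1 (fun x => ?_) fun x hx => ?_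
    · exact mul_nonneg (by positivity)
        (mul_nonneg (allTrue_nonneg _ _) (Finset.prod_nonneg fun j _ => by norm_num))
    · rw [allTrue_eq_one hx.2.2, Finset.prod_pair hef, one_mul]
      have h3 : ∀ k : ℕ, k ≤ M → (1 : ℝ) ≤ 16 ^ M * (1 - 15 / 16) ^ k := by
        intro k hk
        rw [show (1 - 15 / 16 : ℝ) = 16⁻¹ by norm_num, inv_pow, ← div_eq_mul_inv,
          one_le_div (by positivity)]
        exact pow_le_pow_right₀ (by norm_num) hk
      have h4 := one_le_mul_of_one_le_of_one_le (h3 _ hx.1.2) (h3 _ hx.2.1.2)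
      refine h4.trans (le_of_eq ?_)
      rw [two_mul, pow_add]; ring
  rw [bernoulliExp_const_mul] at h2
  refine h2.trans ?_
  rw [mul_assoc]
  refine mul_le_mul_of_nonneg_left (h.trans ?_) (by positivity)
  rw [mul_left_comm (Real.exp _), ← Real.exp_add]
  refine mul_le_mul_of_nonneg_left (Real.exp_le_exp.2 ?_) (by positivity)
  have h5 : (S.card : ℝ) ≤ 5 := by exact_mod_cast hS
  have h6 : (S.card : ℝ) * p ^ 2 ≤ 5 * 1 :=
    mul_le_mul h5 (pow_le_one₀ h0 h1) (by positivity) (by norm_num)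
  push_cast
  nlinarith

-- Eighth factorial moment. Scaled by `(5/3) ^ M` the weights lie in `[0, 1]`, and if the sum
-- exceeds `1/96` they total at least 8, so the sum over 8-tuples of distinct vertices is at least
-- 1. Each tuple requires eight edges at `w` and contributes eight codegree factors with `q = 2/5`.
-- Eight is the least tuple length for which the bound, summed over `a` and `w`, decays when `p = n
-- ^ (-12/25)` and `n p²` is replaced by `2 log n`.
open scoped Classical in
theorem bernoulliProb_highNbrs_le (h0 : 0 ≤ p) (h1 : p ≤ 1) (hp3 : Fintype.card V * p ^ 3 ≤ 1)
    (M : ℕ) (hM : 8 * (3 / 5 : ℝ) ^ M ≤ 1 / 96) (a w : V) :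
    bernoulliProb p (fun x => ¬ ∑ v ∈ (ofMarks x).highNbrs M a w,
        (3 / 5 : ℝ) ^ ((ofMarks x).commonNbrs s(a, v)).card ≤ 1 / 96) ≤
      (5 / 3) ^ (8 * M) * Real.exp 136 * (Fintype.card V ^ 8 * (p ^ 8 *
        Real.exp (-(16 / 5 * (Fintype.card V * p ^ 2))))) := by
  set Z : (Sym2 V → Bool) → V → ℝ := fun x v => if v ∈ (ofMarks x).highNbrs M a w then
    (5 / 3) ^ M * (3 / 5) ^ ((ofMarks x).commonNbrs s(a, v)).card else 0 with hZ
  have hZ0 : ∀ x v, 0 ≤ Z x v := by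
    intro x v; simp only [hZ]; split_ifs <;> positivity
  have hZ1 : ∀ x v, Z x v ≤ 1 := by
    intro x v
    simp only [hZ]
    split_ifs with hv
    · have hv' : M < ((ofMarks x).commonNbrs s(a, v)).card := by
        simp only [highNbrs, Finset.mem_filter] at hv; exact hv.2.2.2
      calc (5 / 3 : ℝ) ^ M * (3 / 5) ^ ((ofMarks x).commonNbrs s(a, v)).card
          ≤ (5 / 3 : ℝ) ^ M * (3 / 5) ^ M :=
            mul_le_mul_of_nonneg_left
              (pow_le_pow_of_le_one (by norm_num) (by norm_num) hv'.le) (by positivity)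
        _ = 1 := by rw [← mul_pow]; norm_num
    · exact zero_le_one
  -- Here `136 = 8 · 7 + 8 · 10`: the correlation terms with `n p³ ≤ 1`, and the at most ten
  -- vertices of the pattern.
  set B : ℝ := (5 / 3) ^ (8 * M) * Real.exp 136 * (p ^ 8 *
        Real.exp (-(16 / 5 * (Fintype.card V * p ^ 2)))) with hB
  have hB0 : 0 ≤ B := by positivity
  have hmain : ∀ A : Finset V, A.card = 8 → bernoulliExp p (fun x => ∏ v ∈ A, Z x v) ≤ B := by
    intro A hA
    by_cases hAaw : a ∈ A ∨ w ∈ A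
    · refine le_trans (bernoulliExp_mono h0 h1 (g := fun _ => 0) fun x => le_of_eq ?_) ?_
      · rcases hAaw with h | h
        · exact Finset.prod_eq_zero h (by simp [hZ, highNbrs])
        · exact Finset.prod_eq_zero h (by simp [hZ, highNbrs])
      · simpa [bernoulliExp] using hB0
    push Not at hAaw
    have hinj : ∀ b : V, Function.Injective fun v => s(b, v) := fun b _ _ h => Sym2.congr_right.1 h
    have h := bernoulliExp_pattern_le (q := 2 / 5) h0 h1 (by norm_num) (by norm_num)
      (insert a (insert w A)) (A.image fun v => s(a, v)) (A.image fun v => s(w, v))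
      (by
        intro j hj
        obtain ⟨v, hv, rfl⟩ := Finset.mem_image.1 hj
        have : a ≠ v := fun h => hAaw.1 (h ▸ hv)
        simpa using this)
      (by
        intro j hj
        obtain ⟨v, hv, rfl⟩ := Finset.mem_image.1 hj
        simp [hv])
      (by
        intro j hj
        obtain ⟨v, hv, rfl⟩ := Finset.mem_image.1 hj
        simp [hv])
    rw [Finset.card_image_of_injective _ (hinj a), Finset.card_image_of_injective _ (hinj w), hA]
      at h
    have h2 : bernoulliExp p (fun x => ∏ v ∈ A, Z x v) ≤ bernoulliExp p (fun x => (5 / 3) ^ (8 * M) *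
        (allTrue (A.image fun v => s(w, v)) x * ∏ j ∈ A.image fun v => s(a, v),
          (1 - 2 / 5) ^ ((ofMarks x).commonNbrs j).card)) := by
      refine bernoulliExp_mono h0 h1 fun x => ?_
      rw [Finset.prod_image fun v _ v' _ hv => hinj a hv]
      by_cases hall : ∀ v ∈ A, v ∈ (ofMarks x).highNbrs M a w
      · rw [allTrue_eq_one]
        · rw [mul_comm 8 M, pow_mul, ← hA, ← Finset.prod_const, one_mul, ← Finset.prod_mul_distrib]
          refine le_of_eq (Finset.prod_congr rfl fun v hv => ?_)
          simp only [hZ, hall v hv, if_true]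
          norm_num
        · intro e he
          obtain ⟨v, hv, rfl⟩ := Finset.mem_image.1 he
          have := hall v hv
          simp only [highNbrs, Finset.mem_filter] at this
          exact this.2.2.1
      · push Not at hall
        obtain ⟨v, hv, hvn⟩ := hall
        rw [Finset.prod_eq_zero hv (by simp [hZ, hvn])]
        exact mul_nonneg (by positivity)
          (mul_nonneg (allTrue_nonneg _ _) (Finset.prod_nonneg fun j _ => by positivity))
    rw [bernoulliExp_const_mul] at h2
    refine h2.trans ?_
    rw [hB, mul_assoc]
    refine mul_le_mul_of_nonneg_left (h.trans ?_) (by positivity)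
    rw [mul_left_comm (Real.exp _), ← Real.exp_add]
    refine mul_le_mul_of_nonneg_left (Real.exp_le_exp.2 ?_) (by positivity)
    have h5 : (insert a (insert w A)).card ≤ 10 := by
      have h6 := Finset.card_insert_le a (insert w A)
      have h7 := Finset.card_insert_le w A
      omega
    have h5' : ((insert a (insert w A)).card : ℝ) ≤ 10 := by exact_mod_cast h5
    have h6 : ((insert a (insert w A)).card : ℝ) * p ^ 2 ≤ 10 * 1 :=
      mul_le_mul h5' (pow_le_one₀ h0 h1) (by positivity) (by norm_num)
    push_cast
    nlinarith
  have h := bernoulliExp_tupleSum_le Z 8 hB0 hmain 8 ∅ Finset.univ (by simp) (by simp)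
  simp only [Finset.prod_empty, one_mul] at h
  refine (bernoulliProb_le_exp h0 h1 (fun x => tupleSum_nonneg (hZ0 x) 8 Finset.univ)
    fun x hx => one_le_tupleSum (hZ0 x) (hZ1 x) 8 _ ?_).trans (h.trans (le_of_eq ?_))
  · rw [not_le] at hx
    have h3 : ∑ v, Z x v = (5 / 3) ^ M * ∑ v ∈ (ofMarks x).highNbrs M a w,
        (3 / 5 : ℝ) ^ ((ofMarks x).commonNbrs s(a, v)).card := by
      simp only [hZ]
      rw [Finset.sum_ite_mem, Finset.univ_inter, Finset.mul_sum]
    rw [h3]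
    have h4 : (8 : ℝ) = (5 / 3) ^ M * (8 * (3 / 5) ^ M) := by
      rw [mul_left_comm, ← mul_pow]; norm_num
    push_cast
    rw [h4]
    exact mul_le_mul_of_nonneg_left (hM.trans hx.le) (by positivity)
  · rw [hB]; ring

end SimpleGraph

namespace SimpleGraph
variable {V : Type*} [Fintype V] {p : ℝ}

theorem bernoulliProb_not_isWellSpread_le (h0 : 0 ≤ p) (h1 : p ≤ 1)
    (hp3 : Fintype.card V * p ^ 3 ≤ 1) (M : ℕ) (hM : 8 * (3 / 5 : ℝ) ^ M ≤ 1 / 96)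
    (N Y : ℝ) (hN : N = Fintype.card V) (hY : Y = N * p ^ 2) :
    bernoulliProb p (fun x : Sym2 V → Bool => ¬ (ofMarks x).IsWellSpread M) ≤
      Real.exp 2 * (N ^ 2 * Real.exp (-Y)) +
      (5 / 3) ^ (8 * M) * Real.exp 136 * (N ^ 10 * p ^ 8 * Real.exp (-(16 / 5 * Y))) +
      16 ^ (2 * M) * Real.exp 12 * (N ^ 3 * p ^ 0 * Real.exp (-(15 / 8 * Y)) +
        N ^ 4 * p ^ 1 * Real.exp (-(15 / 8 * Y)) + N ^ 5 * p ^ 3 * Real.exp (-(15 / 8 * Y))) := by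
  classical
  subst hY hN
  have e0 := bernoulliProb_exists_le (κ := V × V) h0 h1
    (fun t (x : Sym2 V → Bool) => t.1 ≠ t.2 ∧ ((ofMarks x).commonNbrs s(t.1, t.2)).card = 0)
    (B := Real.exp 2 * Real.exp (-(Fintype.card V * p ^ 2))) (by
      rintro ⟨u, v⟩
      refine bernoulliProb_le_zero_or (by positivity) (fun x hx => hx.1) fun huv => ?_
      exact (bernoulliProb_mono h0 h1 fun x hx => hx.2).trans
        (bernoulliProb_commonNbrs_eq_empty_le h0 h1 (by simpa using huv)))
  have e1 := bernoulliProb_exists_le (κ := V × V) h0 h1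
    (fun t (x : Sym2 V → Bool) => ¬ ∑ v ∈ (ofMarks x).highNbrs M t.1 t.2,
        (3 / 5 : ℝ) ^ ((ofMarks x).commonNbrs s(t.1, v)).card ≤ 1 / 96)
    fun t => bernoulliProb_highNbrs_le h0 h1 hp3 M hM t.1 t.2
  have e2 := bernoulliProb_exists_le (κ := V × V × V) h0 h1
    (fun t (x : Sym2 V → Bool) => t.2.1 ≠ t.2.2 ∧ (ofMarks x).IsLow M s(t.1, t.2.1) ∧
      (ofMarks x).IsLow M s(t.1, t.2.2))
    (B := 16 ^ (2 * M) * Real.exp 12 * (p ^ 0 *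
        Real.exp (-(15 / 8 * (Fintype.card V * p ^ 2))))) (by
      rintro ⟨a, b, c⟩
      refine bernoulliProb_le_zero_or (by positivity) (fun x hx => hx.1) fun hbc => ?_
      refine (bernoulliProb_mono h0 h1 fun x hx => ?_).trans
        (bernoulliProb_two_low_le h0 h1 hp3 M {a, b, c}
          (Finset.card_le_three.trans (by norm_num)) ∅ (e := s(a, b)) (f := s(a, c))
          (fun h => hbc (Sym2.congr_right.1 h)) (by simp) (by simp) (by simp))
      exact ⟨hx.2.1, hx.2.2, by simp⟩)
  have e3 := bernoulliProb_exists_le (κ := V × V × V × V) h0 h1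
    (fun t (x : Sym2 V → Bool) => s(t.1, t.2.1) ≠ s(t.2.2.1, t.2.2.2) ∧
      (ofMarks x).IsLow M s(t.1, t.2.1) ∧ (ofMarks x).IsLow M s(t.2.2.1, t.2.2.2) ∧
      (ofMarks x).Adj t.1 t.2.2.1)
    (B := 16 ^ (2 * M) * Real.exp 12 * (p ^ 1 *
        Real.exp (-(15 / 8 * (Fintype.card V * p ^ 2))))) (by
      rintro ⟨a, b, c, d⟩
      refine bernoulliProb_le_zero_or (by positivity) (fun x hx => hx.1) fun hne => ?_
      refine (bernoulliProb_mono h0 h1 fun x hx => ?_).trans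
        (bernoulliProb_two_low_le h0 h1 hp3 M {a, b, c, d}
          (Finset.card_le_four.trans (by norm_num)) {s(a, c)} (e := s(a, b)) (f := s(c, d))
          hne (by simp) (by simp) (by simp))
      exact ⟨hx.2.1, hx.2.2.1, by simpa using hx.2.2.2⟩)
  have e4 := bernoulliProb_exists_le (κ := V × V × V × V × V) h0 h1
    (fun t (x : Sym2 V → Bool) => (s(t.2.1, t.2.2.1) ≠ s(t.2.2.2.1, t.2.2.2.2) ∧
      t.2.1 ≠ t.2.2.1 ∧ t.2.1 ≠ t.2.2.2.1 ∧ t.2.2.1 ≠ t.2.2.2.1) ∧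
      (ofMarks x).IsLow M s(t.2.1, t.2.2.1) ∧ (ofMarks x).IsLow M s(t.2.2.2.1, t.2.2.2.2) ∧
      (ofMarks x).Adj t.1 t.2.1 ∧ (ofMarks x).Adj t.1 t.2.2.1 ∧ (ofMarks x).Adj t.1 t.2.2.2.1)
    (B := 16 ^ (2 * M) * Real.exp 12 * (p ^ 3 *
        Real.exp (-(15 / 8 * (Fintype.card V * p ^ 2))))) (by
      rintro ⟨u, a, b, c, d⟩
      refine bernoulliProb_le_zero_or (by positivity) (fun x hx => hx.1)
        fun ⟨hne, hab, hac, hbc⟩ => ?_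
      -- The side conditions keep the three edges at `u` distinct, so that they really give the
      -- factor `p ^ 3`.
      have hD : ({s(u, a), s(u, b), s(u, c)} : Finset (Sym2 V)).card = 3 := by
        rw [Finset.card_eq_three]
        exact ⟨_, _, _, fun h => hab (Sym2.congr_right.1 h), fun h => hac (Sym2.congr_right.1 h),
          fun h => hbc (Sym2.congr_right.1 h), rfl⟩
      rw [← hD]
      refine (bernoulliProb_mono h0 h1 fun x hx => ?_).trans
        (bernoulliProb_two_low_le h0 h1 hp3 M {u, a, b, c, d}
          Finset.card_le_five {s(u, a), s(u, b), s(u, c)} (e := s(a, b)) (f := s(c, d))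
          hne (by simp) (by simp) (by simp))
      exact ⟨hx.2.1, hx.2.2.1, by simpa using hx.2.2.2⟩)
  have e34 := (bernoulliProb_or_le h0 h1 _ _).trans (add_le_add e3 e4)
  have e234 := (bernoulliProb_or_le h0 h1 _ _).trans (add_le_add e2 e34)
  have e1234 := (bernoulliProb_or_le h0 h1 _ _).trans (add_le_add e1 e234)
  have e01234 := (bernoulliProb_or_le h0 h1 _ _).trans (add_le_add e0 e1234)
  refine (bernoulliProb_mono h0 h1 fun x hx => ?_).trans (e01234.trans (le_of_eq ?_))
  · by_contra hcon
    push Not at hcon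
    obtain ⟨c0, c1, c2, c3, c4⟩ := hcon
    refine hx ⟨?_, ?_, ?_, ?_, ?_⟩
    · intro e he
      induction e with | _ u v
      exact Nat.pos_of_ne_zero (c0 (u, v) (by simpa using he))
    · exact fun a w _ => c1 (a, w)
    · intro a b c hab hac
      by_contra hbc
      exact c2 (a, b, c) hbc hab hac
    · intro a b c d hac had _ _ hab hcd
      exact c3 (a, b, c, d) (by simp [hac, had]) hab hcd
    · intro u a b c d _ hac had hbc _ hab hcd h
      exact c4 (u, a, b, c, d) ⟨by simp [hac, had], by simpa using hab.1, hac, hbc⟩ hab hcd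
        h.1 h.2.1 h.2.2
  · simp only [Fintype.card_prod, Nat.cast_mul]
    ring

theorem bernoulliProb_not_exists_colouring_le (h0 : 0 ≤ p) (h1 : p ≤ 1) :
    bernoulliProb p (fun x : Sym2 V → Bool => ¬ ∃ c : Sym2 V → Bool, ∀ e : Sym2 V,
      ¬ e.IsDiag → ¬ (ofMarks x).MonoCherries e c) ≤
      Real.exp 2 * ((Fintype.card V : ℝ) ^ 2 * Real.exp (-(Fintype.card V * p ^ 2 / 2))) := by
  classical
  set I := Finset.univ.filter (fun e : Sym2 V => ¬ e.IsDiag) with hI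
  have h2 : ∀ e ∈ I, bernoulliExp p
      (fun x => (1 / 2 : ℝ) ^ ((ofMarks x).commonNbrs e).card) ≤
      Real.exp 2 * Real.exp (-(Fintype.card V * p ^ 2 / 2)) := by
    intro e he
    have hed : ¬ e.IsDiag := by simpa [hI] using he
    have h := bernoulliExp_pattern_le (q := 1 / 2) h0 h1 (by norm_num) (by norm_num)
      e.toFinset {e} ∅ (by simpa using hed) (by simp) (by simp)
    have hc := Sym2.card_toFinset_of_not_isDiag e hed
    simp only [allTrue, Finset.notMem_empty, false_imp_iff, implies_true, if_true, one_mul,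
      Finset.prod_singleton, Finset.card_empty, pow_zero, Finset.card_singleton, hc] at h
    rw [show (1 - 1 / 2 : ℝ) = 1 / 2 by norm_num] at h
    refine h.trans ?_
    rw [← Real.exp_add, Real.exp_le_exp]
    push_cast
    nlinarith [pow_le_one₀ (n := 2) h0 h1]
  refine (bernoulliProb_le_exp h0 h1 (f := fun x => ∑ e ∈ I,
    (1 / 2 : ℝ) ^ ((ofMarks x).commonNbrs e).card)
    (fun x => Finset.sum_nonneg fun e _ => by positivity) fun x hx => ?_).trans ?_
  · by_contra hlt
    exact hx (exists_colouring_of_sum_lt _ (by simpa [hI] using hlt))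
  · rw [bernoulliExp_sum]
    refine (Finset.sum_le_sum h2).trans ?_
    have h3 : I.card ≤ Fintype.card V ^ 2 := by
      refine (Finset.card_le_univ I).trans ?_
      rw [sq, ← Fintype.card_prod]
      exact Fintype.card_le_of_surjective (fun q : V × V => s(q.1, q.2))
        (fun e => by induction e with | _ u v; exact ⟨(u, v), rfl⟩)
    have h4 : (I.card : ℝ) ≤ (Fintype.card V : ℝ) ^ 2 := by exact_mod_cast h3
    rw [Finset.sum_const, nsmul_eq_mul, mul_left_comm]
    exact mul_le_mul_of_nonneg_left
      (mul_le_mul_of_nonneg_right h4 (Real.exp_pos _).le) (Real.exp_pos _).le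

theorem bernoulliProb_eq_top_le (h0 : 0 ≤ p) (h1 : p ≤ 1) :
    bernoulliProb p (fun x : Sym2 V → Bool => ofMarks x = ⊤) ≤
      p ^ (Fintype.card V).choose 2 := by
  classical
  have hc : (Finset.univ.filter (fun e : Sym2 V => ¬ e.IsDiag)).card =
      (Fintype.card V).choose 2 := by
    rw [← Fintype.card_subtype, Sym2.card_subtype_not_diag]
  rw [← hc, ← bernoulliExp_allTrue]
  refine bernoulliProb_le_exp h0 h1 (fun x => allTrue_nonneg _ _) fun x hx => ?_
  rw [allTrue_eq_one]
  intro e he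
  rw [hx]
  simpa using he

theorem measureReal_compl_rainbow_le (p : unitInterval) :
    1 - (binomialRandom V p).real {G | G.rainbowConnectionNumber = 2} ≤
      (p : ℝ) ^ (Fintype.card V).choose 2 +
      bernoulliProb (p : ℝ) (fun x : Sym2 V → Bool => ¬ ∃ c : Sym2 V → Bool, ∀ e : Sym2 V,
        ¬ e.IsDiag → ¬ (ofMarks x).MonoCherries e c) := by
  have h0 := p.2.1
  have h1 := p.2.2
  have h2 : (binomialRandom V p).real {G | G.rainbowConnectionNumber = 2} =
      bernoulliProb (p : ℝ) (fun x : Sym2 V → Bool =>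
        (ofMarks x).rainbowConnectionNumber = 2) := by
    rw [binomialRandom_real_eq]; rfl
  rw [h2, bernoulliProb_compl, sub_sub_cancel]
  refine (bernoulliProb_mono h0 h1 fun x hx => ?_).trans ((bernoulliProb_or_le h0 h1 _ _).trans
    (add_le_add (bernoulliProb_eq_top_le h0 h1) le_rfl))
  by_contra hcon
  push Not at hcon
  obtain ⟨htop, c, hc⟩ := hcon
  exact hx (le_antisymm (rainbowConnectionNumber_le_two hc) (two_le_rainbowConnectionNumber htop))

/-! ### Combining the two regimes, and asymptotics. -/

theorem pow_mul_pow_mul_exp_le {N p Y c : ℝ} (hN : 1 ≤ N) (hp0 : 0 ≤ p)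
    (hp : p ≤ N ^ (-(12 / 25) : ℝ)) (hY : 2 * Real.log N ≤ Y) (hc : 0 ≤ c) (a b : ℕ) :
    N ^ a * p ^ b * Real.exp (-(c * Y)) ≤ N ^ (a - 12 / 25 * b - 2 * c : ℝ) := by
  have hN0 : 0 < N := by linarith
  have h1 : p ^ b ≤ N ^ (-(12 / 25) * b : ℝ) := by
    rw [Real.rpow_mul hN0.le, Real.rpow_natCast]
    exact pow_le_pow_left₀ hp0 hp b
  have h2 : Real.exp (-(c * Y)) ≤ N ^ (-(2 * c) : ℝ) := by
    rw [Real.rpow_def_of_pos hN0, Real.exp_le_exp]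
    nlinarith
  calc _ ≤ N ^ (a : ℝ) * N ^ (-(12 / 25) * b : ℝ) * N ^ (-(2 * c) : ℝ) := by
        rw [Real.rpow_natCast]; gcongr
    _ = _ := by
      rw [← Real.rpow_add hN0, ← Real.rpow_add hN0]
      congr 1; ring

theorem bernoulliProb_not_exists_colouring_le_of_two_mul_log_le (h0 : 0 ≤ p) (h1 : p ≤ 1)
    {N w : ℝ} (hN : N = Fintype.card V) (hN1 : 1 ≤ N) (hw : 0 ≤ w)
    (hp : N * p ^ 2 = 2 * Real.log N + w) :
    bernoulliProb p (fun x : Sym2 V → Bool => ¬ ∃ c : Sym2 V → Bool, ∀ e : Sym2 V,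
      ¬ e.IsDiag → ¬ (ofMarks x).MonoCherries e c) ≤
      Real.exp 2 * (N ^ 2 * Real.exp (-(N ^ (1 / 25 : ℝ) / 2))) +
      (Real.exp 2 * Real.exp (-w) +
      (5 / 3) ^ (8 * 60) * Real.exp 136 * N ^ (-(6 / 25) : ℝ) +
      16 ^ (2 * 60) * Real.exp 12 * (N ^ (-(3 / 4) : ℝ) +
        N ^ (-(23 / 100) : ℝ) + N ^ (-(19 / 100) : ℝ))) := by
  have hN0 : 0 < N := by linarith
  -- Any threshold `N ^ (-α)` with `9/20 < α < 1/2` would do: the eighth moment term needs the lower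
  -- bound on `α`, the union bound the upper one.
  rcases le_or_gt p (N ^ (-(12 / 25) : ℝ)) with hle | hgt
  · have hY : 2 * Real.log N ≤ N * p ^ 2 := by linarith
    have hp3 : Fintype.card V * p ^ 3 ≤ 1 := by
      have := pow_mul_pow_mul_exp_le hN1 h0 hle hY le_rfl 1 3
      rw [zero_mul, neg_zero, Real.exp_zero, mul_one, pow_one, hN] at this
      refine this.trans (Real.rpow_le_one_of_one_le_of_nonpos (hN ▸ hN1) (by norm_num))
    -- The value 60 satisfies both `57 ≤ M` and `8 (3/5) ^ M ≤ 1/96`.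
    have h := bernoulliProb_not_isWellSpread_le h0 h1 hp3 60 (by norm_num) N _ hN rfl
    have h2 : bernoulliProb p (fun x : Sym2 V → Bool => ¬ ∃ c : Sym2 V → Bool, ∀ e : Sym2 V,
        ¬ e.IsDiag → ¬ (ofMarks x).MonoCherries e c) ≤ _ :=
      (bernoulliProb_mono h0 h1 fun x hx hws => hx (hws.exists_colouring (by norm_num))).trans h
    refine h2.trans (le_trans ?_ (le_add_of_nonneg_left (by positivity)))
    have t0 : N ^ 2 * Real.exp (-(N * p ^ 2)) = Real.exp (-w) := by
      rw [hp, neg_add, Real.exp_add, ← mul_assoc, ← neg_mul, neg_mul, Real.exp_neg,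
        show (2 : ℝ) * Real.log N = (2 : ℕ) * Real.log N by norm_num, Real.exp_nat_mul,
        Real.exp_log hN0, mul_inv_cancel₀ (by positivity), one_mul]
    have t1 := pow_mul_pow_mul_exp_le hN1 h0 hle hY (c := 16 / 5) (by norm_num) 10 8
    have t2 := pow_mul_pow_mul_exp_le hN1 h0 hle hY (c := 15 / 8) (by norm_num) 3 0
    have t3 := pow_mul_pow_mul_exp_le hN1 h0 hle hY (c := 15 / 8) (by norm_num) 4 1
    have t4 := pow_mul_pow_mul_exp_le hN1 h0 hle hY (c := 15 / 8) (by norm_num) 5 3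
    norm_num only at t1 t2 t3 t4 ⊢
    rw [t0]
    gcongr
  · have hY : N ^ (1 / 25 : ℝ) ≤ N * p ^ 2 := by
      have h2 : N ^ (1 / 25 : ℝ) = N * (N ^ (-(12 / 25) : ℝ)) ^ 2 := by
        rw [← Real.rpow_natCast, ← Real.rpow_mul hN0.le]
        nth_rewrite 2 [← Real.rpow_one N]
        rw [← Real.rpow_add hN0]
        norm_num
      rw [h2]
      gcongr
    refine (bernoulliProb_not_exists_colouring_le h0 h1).trans ?_
    rw [← hN]
    refine le_trans ?_ (le_add_of_nonneg_right (by positivity))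
    gcongr

end SimpleGraph

theorem tendsto_sq_mul_exp_neg_rpow :
    Tendsto (fun x : ℝ => x ^ 2 * Real.exp (-(x ^ (1 / 25 : ℝ) / 2))) atTop (𝓝 0) := by
  have h1 : Tendsto (fun x : ℝ => x ^ (1 / 25 : ℝ) / 2) atTop atTop :=
    (tendsto_rpow_atTop (by norm_num)).atTop_div_const (by norm_num)
  -- With `t = x ^ (1/25) / 2` one has `x ^ 2 = 2 ^ 50 * t ^ 50`.
  have h2 := ((Real.tendsto_pow_mul_exp_neg_atTop_nhds_zero 50).comp h1).const_mul (2 ^ 50)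
  rw [mul_zero] at h2
  refine h2.congr' ?_
  filter_upwards [eventually_ge_atTop 0] with x hx
  simp only [Function.comp]
  rw [div_pow, ← mul_assoc, mul_div_cancel₀ _ (by positivity), ← Real.rpow_natCast (x ^ _),
    ← Real.rpow_mul hx]
  norm_num

/-- Combines `p ≤ exp (-(1 - p))` with `n.choose 2 ≥ n² / 4`, valid for `n ≥ 2`. -/
theorem unitInterval_pow_choose_two_le (p : unitInterval) {n : ℕ} (hn : 2 ≤ n) :
    (p : ℝ) ^ n.choose 2 ≤ Real.exp (-((1 - (p : ℝ)) * (n : ℝ) ^ 2 / 4)) := by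
  have hp1 := p.2.2
  have hp : (p : ℝ) ≤ Real.exp (-(1 - p)) := by
    have := Real.add_one_le_exp (-(1 - (p : ℝ)))
    linarith
  have hn' : (2 : ℝ) ≤ n := by exact_mod_cast hn
  calc (p : ℝ) ^ n.choose 2 ≤ Real.exp (-(1 - p)) ^ n.choose 2 := pow_le_pow_left₀ p.2.1 hp _
    _ = Real.exp (n.choose 2 * -(1 - p)) := (Real.exp_nat_mul _ _).symm
    _ ≤ _ := by
      rw [Real.exp_le_exp, Nat.cast_choose_two]
      have : (0 : ℝ) ≤ (1 - p) * ((n : ℝ) * (n - 2)) :=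
        mul_nonneg (by linarith) (mul_nonneg (by linarith) (by linarith))
      nlinarith

/-- The binomial random graph `G(n, p n)` on the vertex set `Fin n` is Mathlib's
`SimpleGraph.binomialRandom (Fin n) (p n)`. -/
theorem mainTheorem6 (p : ℕ → unitInterval) (ω : ℕ → ℝ)
    (hp : ∀ᶠ n : ℕ in atTop, (p n : ℝ) = Real.sqrt ((2 * Real.log (n : ℝ) + ω n) / (n : ℝ)))
    (hω : Tendsto ω atTop atTop)
    (hcomplete : Tendsto (fun n : ℕ => (1 - (p n : ℝ)) * (n : ℝ) ^ 2) atTop atTop) :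
    Tendsto
      (fun n : ℕ => SimpleGraph.binomialRandom (Fin n) (p n)
        {G : SimpleGraph (Fin n) | G.rainbowConnectionNumber = 2})
      atTop (𝓝 1) := by
  set P : ℕ → ℝ := fun n => (SimpleGraph.binomialRandom (Fin n) (p n)).real
    {G : SimpleGraph (Fin n) | G.rainbowConnectionNumber = 2} with hP
  set b : ℕ → ℝ := fun n => Real.exp (-((1 - (p n : ℝ)) * (n : ℝ) ^ 2 / 4)) +
      (Real.exp 2 * ((n : ℝ) ^ 2 * Real.exp (-((n : ℝ) ^ (1 / 25 : ℝ) / 2))) +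
      (Real.exp 2 * Real.exp (-ω n) +
      (5 / 3) ^ (8 * 60) * Real.exp 136 * (n : ℝ) ^ (-(6 / 25) : ℝ) +
      16 ^ (2 * 60) * Real.exp 12 * ((n : ℝ) ^ (-(3 / 4) : ℝ) +
        (n : ℝ) ^ (-(23 / 100) : ℝ) + (n : ℝ) ^ (-(19 / 100) : ℝ)))) with hb
  have hexp : ∀ {f : ℕ → ℝ}, Tendsto f atTop atTop →
      Tendsto (fun n => Real.exp (-f n)) atTop (𝓝 0) := fun hf =>
    Real.tendsto_exp_neg_atTop_nhds_zero.comp hf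
  have hpow : ∀ c : ℝ, 0 < c → Tendsto (fun n : ℕ => (n : ℝ) ^ (-c)) atTop (𝓝 0) := fun c hc =>
    (tendsto_rpow_neg_atTop hc).comp tendsto_natCast_atTop_atTop
  have hb0 : Tendsto b atTop (𝓝 0) := by
    have h1 := hexp (hcomplete.atTop_div_const (by norm_num : (0 : ℝ) < 4))
    have h2 := (tendsto_sq_mul_exp_neg_rpow.comp tendsto_natCast_atTop_atTop).const_mul (Real.exp 2)
    have h3 := (hexp hω).const_mul (Real.exp 2)
    have h4 := (hpow (6 / 25) (by norm_num)).const_mul ((5 / 3) ^ (8 * 60) * Real.exp 136)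
    have h5 := (((hpow (3 / 4) (by norm_num)).add (hpow (23 / 100) (by norm_num))).add
      (hpow (19 / 100) (by norm_num))).const_mul (16 ^ (2 * 60) * Real.exp 12)
    have h := h1.add (h2.add ((h3.add h4).add h5))
    simp only [mul_zero, add_zero] at h
    exact h
  have hle : ∀ᶠ n in atTop, 1 - b n ≤ P n := by
    filter_upwards [hp, hω.eventually_ge_atTop 0, eventually_ge_atTop 2] with n hpn hωn hn
    have hn1 : (1 : ℝ) ≤ n := by exact_mod_cast (by omega : 1 ≤ n)
    have hsq : (n : ℝ) * (p n : ℝ) ^ 2 = 2 * Real.log n + ω n := by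
      have hlog := Real.log_nonneg hn1
      rw [hpn, Real.sq_sqrt (div_nonneg (by linarith) (by linarith)),
        mul_div_cancel₀ _ (by positivity)]
    have h1 := SimpleGraph.measureReal_compl_rainbow_le (V := Fin n) (p n)
    have h2 := SimpleGraph.bernoulliProb_not_exists_colouring_le_of_two_mul_log_le (V := Fin n)
      (p n).2.1 (p n).2.2 (N := n) (by simp) hn1 hωn hsq
    rw [Fintype.card_fin] at h1
    have h3 := unitInterval_pow_choose_two_le (p n) hn
    simp only [hP, hb]
    linarith
  have hP1 : Tendsto P atTop (𝓝 1) := by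
    refine tendsto_of_tendsto_of_tendsto_of_le_of_le' ?_ tendsto_const_nhds hle
      (Eventually.of_forall fun n => MeasureTheory.measureReal_le_one)
    simpa using hb0.const_sub 1
  have hfin := ENNReal.tendsto_ofReal hP1
  rw [ENNReal.ofReal_one] at hfin
  refine hfin.congr fun n => ?_
  exact MeasureTheory.ofReal_measureReal
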